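/- Let $N\ge 0$, let $0<\lambda_1<\lambda_2<\dots<\lambda_{2N+1}$, and put $$\Gamma^+=[0,\lambda_1]\cup[\lambda_2,\lambda_3]\cup\dots\cup[\lambda_{2N},\lambda_{2N+1}],\qquad \Gamma=\Gamma^+\cup(-\Gamma^+).$$ Let $R(\eta)=\sqrt{(\eta^2-\lambda_1^2)(\eta^2-\lambda_2^2)\cdots(\eta^2-\lambda_{2N+1}^2)}$ be the branch that is holomorphic on $\mathbb C\setminus\Gamma$ with $R(\eta)\sim\eta^{2N+1}$ as $\eta\to\infty$; for $\eta\in\Gamma$ the value $R(\eta)$ is taken on the upper shore of the cut. Consider $$dp=\frac{iP(\eta)}{\pi R(\eta)}\,d\eta,\qquad dq=\frac{12\,iQ(\eta)}{\pi R(\eta)}\,d\eta,$$ where $P$ and $Q$ are odd monic polynomials with complex coefficients, of degrees $2N+1$ and $2N+3$, such that $$\int_{\lambda_{2j-1}}^{\lambda_{2j}}dp=\int_{\lambda_{2j-1}}^{\lambda_{2j}}dq=0,\qquad j=1,\dots,N,$$ and such that $dq$ has no constant term at infinity, i.e. $Q(\eta)/R(\eta)-\eta^2\to0$ as $\eta\to\infty$.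 Theorem. These conditions determine $P$ and $Q$ uniquely (and such $P$, $Q$ exist). Put $u=dp/d\eta$ and $v=dq/d\eta$. Then, with all pointwise claims about $u$, $v$ and the Hilbert transform understood away from the endpoints $\pm\lambda_j$ (where $R=0$): 1. $u$ and $v$ are odd and real valued on $\Gamma$. 2. $u$ and $v$ are integrable on $\Gamma$, and $$H[u](\eta)=\frac1\pi,\qquad H[v](\eta)=\frac{12\eta^2}{\pi}\qquad\text{for }\eta\in\Gamma,$$ where $H[f](\xi)=\frac1\pi\,\mathrm{p.v.}\!\int_\Gamma\frac{f(y)\,dy}{y-\xi}$ is the finite Hilbert transform on $\Gamma$. 3. $u$ and $v$ solve the soliton gas dispersion relations with $\sigma=0$: for every $\eta\in\Gamma^+$ (endpoints included), with absolutely convergent integrals, $$\int_{\Gamma^+}\ln\left|\frac{\mu+\eta}{\mu-\eta}\right|u(\mu)\,d\mu=\eta,\qquad \int_{\Gamma^+}\ln\left|\frac{\mu+\eta}{\mu-\eta}\right|v(\mu)\,d\mu=4\eta^3.$$ 4. $u(\eta)\ge0$ on $\Gamma^+$. -/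

import Mathlib

open Filter Topology MeasureTheory Polynomial

namespace SolitonCondensate

noncomputable section

/-- The branch of `√((z - a)(z - b))` with branch cut `[a, b]` that behaves like `z` at infinity.
The power is the principal one. For real `z` strictly between `a` and `b` it takes the value
`i √((z - a)(b - z))`, the limit from the upper half plane (see `tendsto_root_upper`). -/
def bandRoot (a b : ℝ) (z : ℂ) : ℂ :=
  (z - a) * ((z - b) / (z - a)) ^ (1 / 2 : ℂ)

/-- `Γ⁺ = [0, λ₁] ∪ [λ₂, λ₃] ∪ … ∪ [λ_{2N}, λ_{2N+1}]`. Only `lam 1, …, lam (2 * N + 1)` are used,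
here and below. -/
def bandsPos (N : ℕ) (lam : ℕ → ℝ) : Set ℝ :=
  Set.Icc 0 (lam 1) ∪ ⋃ k ∈ Finset.Icc 1 N, Set.Icc (lam (2 * k)) (lam (2 * k + 1))

/-- `Γ = Γ⁺ ∪ (-Γ⁺)`. -/
def bands (N : ℕ) (lam : ℕ → ℝ) : Set ℝ :=
  bandsPos N lam ∪ {x | -x ∈ bandsPos N lam}

/-- The branch points `±λ₁, …, ±λ_{2N+1}`. -/
def branchPoints (N : ℕ) (lam : ℕ → ℝ) : Set ℝ :=
  {x | ∃ j ∈ Finset.Icc 1 (2 * N + 1), x = lam j ∨ x = -lam j}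

/-- `R(z) = √((z² - λ₁²) ⋯ (z² - λ_{2N+1}²))`, the branch on the plane cut along `Γ` that behaves
like `z ^ (2 N + 1)` at infinity. On `Γ` its value is the one on the upper shore of the cut. The
lemmas below confirm each of these properties. -/
def root (N : ℕ) (lam : ℕ → ℝ) (z : ℂ) : ℂ :=
  bandRoot (-lam 1) (lam 1) z *
    ∏ k ∈ Finset.Icc 1 N,
      (bandRoot (lam (2 * k)) (lam (2 * k + 1)) z *
        bandRoot (-lam (2 * k + 1)) (-lam (2 * k)) z)

/-- `dp/dη = i P(η) / (π R(η))`. -/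
def dp (N : ℕ) (lam : ℕ → ℝ) (P : ℂ[X]) (z : ℂ) : ℂ :=
  Complex.I * P.eval z / (Real.pi * root N lam z)

/-- `dq/dη = 12 i Q(η) / (π R(η))`. -/
def dq (N : ℕ) (lam : ℕ → ℝ) (Q : ℂ[X]) (z : ℂ) : ℂ :=
  12 * Complex.I * Q.eval z / (Real.pi * root N lam z)

/-- `p` is a monic odd polynomial of degree `d`. -/
def IsOddMonic (d : ℕ) (p : ℂ[X]) : Prop :=
  p.Monic ∧ p.natDegree = d ∧ p.comp (-X) = -p

/-- All the integrals of `f(η) dη` over the gaps `(λ_{2j-1}, λ_{2j})`, `1 ≤ j ≤ N`, vanish. -/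
def GapIntegralsVanish (N : ℕ) (lam : ℕ → ℝ) (f : ℂ → ℂ) : Prop :=
  ∀ j ∈ Finset.Icc 1 N, ∫ x in (lam (2 * j - 1))..(lam (2 * j)), f (x : ℂ) = 0

/-- `P` is the numerator of the normalized differential `dp`. -/
def IsNumeratorP (N : ℕ) (lam : ℕ → ℝ) (P : ℂ[X]) : Prop :=
  IsOddMonic (2 * N + 1) P ∧ GapIntegralsVanish N lam (dp N lam P)

/-- `Q` is the numerator of the normalized differential `dq`. The singular part of `dq` at infinity
is that of `(12 i / π) η² dη`: there is no term `const · dη`. -/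
def IsNumeratorQ (N : ℕ) (lam : ℕ → ℝ) (Q : ℂ[X]) : Prop :=
  IsOddMonic (2 * N + 3) Q ∧ GapIntegralsVanish N lam (dq N lam Q) ∧
    Tendsto (fun z : ℂ => dq N lam Q z - 12 * Complex.I / Real.pi * z ^ 2)
      (Bornology.cobounded ℂ) (𝓝 0)

/-- The finite Hilbert transform `(1/π) ∫_G f(y) / (y - ξ) dy` exists at `ξ`, as a Cauchy principal
value, and equals `a`. -/
def HasHilbertTransform (G : Set ℝ) (f : ℝ → ℂ) (ξ : ℝ) (a : ℂ) : Prop :=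
  Tendsto
    (fun ε : ℝ => (1 / Real.pi : ℂ) * ∫ y in G \ Set.Ioo (ξ - ε) (ξ + ε), f y / ((y : ℂ) - ξ))
    (𝓝[>] 0) (𝓝 a)

/-- `f` solves the dispersion relation
`∫_G log |(μ + η) / (μ - η)| f(μ) dμ + f(η) σ(η) = g(η)` for all `η ∈ G`, with absolutely
convergent integrals. -/
def SolvesNDR (G : Set ℝ) (σ : ℝ → ℝ) (g : ℝ → ℝ) (f : ℝ → ℂ) : Prop :=
  ∀ η ∈ G,
    IntegrableOn (fun μ : ℝ => (Real.log |(μ + η) / (μ - η)| : ℂ) * f μ) G ∧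
    (∫ μ in G, (Real.log |(μ + η) / (μ - η)| : ℂ) * f μ) + f η * σ η = g η

theorem bandRoot_sq (a b : ℝ) (z : ℂ) : bandRoot a b z ^ 2 = (z - a) * (z - b) := by
  unfold bandRoot
  rw [mul_pow, ← Complex.cpow_nat_mul]
  by_cases h : z - a = 0
  · simp [h]
  · norm_num
    field_simp

theorem root_sq (N : ℕ) (lam : ℕ → ℝ) (z : ℂ) :
    root N lam z ^ 2 = ∏ j ∈ Finset.Icc 1 (2 * N + 1), (z ^ 2 - (lam j : ℂ) ^ 2) := by
  unfold root
  rw [mul_pow, ← Finset.prod_pow]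
  simp only [mul_pow, bandRoot_sq]
  induction N with
  | zero => simp; ring
  | succ n ih =>
    rw [Finset.prod_Icc_succ_top (by omega), ← mul_assoc, ih,
      show 2 * (n + 1) + 1 = (2 * n + 1) + 1 + 1 by ring,
      Finset.prod_Icc_succ_top (b := 2 * n + 1 + 1) (by omega),
      Finset.prod_Icc_succ_top (b := 2 * n + 1) (by omega),
      show 2 * (n + 1) = 2 * n + 1 + 1 by ring]
    push_cast
    ring

theorem differentiableAt_bandRoot {a b : ℝ} {z : ℂ}
    (hz : ∀ x : ℝ, a ≤ x → x ≤ b → z ≠ x) (hab : a < b) :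
    DifferentiableAt ℂ (bandRoot a b) z := by
  have hza : z - a ≠ 0 := sub_ne_zero.2 (hz a le_rfl hab.le)
  have hslit : (z - b) / (z - a) ∈ Complex.slitPlane := by
    rw [Complex.mem_slitPlane_iff]
    by_contra hcon
    push Not at hcon
    obtain ⟨hre, him⟩ := hcon
    set t : ℝ := ((z - b) / (z - a)).re with ht
    have hw : (z - b) / (z - a) = (t : ℂ) := Complex.ext (by simp [ht]) (by simp [him])
    rw [div_eq_iff hza] at hw
    have h1 : (1 - t : ℝ) ≠ 0 := by linarith
    have hzt : z = (((b - t * a) / (1 - t) : ℝ) : ℂ) := by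
      push_cast
      have h1' : (1 - t : ℂ) ≠ 0 := by exact_mod_cast h1
      rw [eq_div_iff h1']
      linear_combination hw
    refine hz _ ?_ ?_ hzt
    · rw [le_div_iff₀ (by linarith)]; nlinarith
    · rw [div_le_iff₀ (by linarith)]; nlinarith
  have hid : DifferentiableAt ℂ (fun w : ℂ => w) z := differentiableAt_id
  unfold bandRoot
  exact (hid.sub_const _).mul
    (((hid.sub_const _).div (hid.sub_const _) hza).cpow (differentiableAt_const _) hslit)

/-- `R` is holomorphic off the cuts. -/
theorem differentiableAt_root {N : ℕ} {lam : ℕ → ℝ} (hpos : 0 < lam 1)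
    (hmono : StrictMonoOn lam (Set.Icc 1 (2 * N + 1))) {z : ℂ}
    (hz : ∀ x ∈ bands N lam, z ≠ (x : ℂ)) : DifferentiableAt ℂ (root N lam) z := by
  unfold root
  refine (differentiableAt_bandRoot (fun x h1 h2 => hz x ?_) (by linarith)).mul ?_
  · rcases le_total 0 x with h | h
    · exact Or.inl (Or.inl ⟨h, h2⟩)
    · exact Or.inr (Or.inl ⟨by linarith, by linarith⟩)
  · refine DifferentiableAt.fun_finsetProd fun k hk => ?_
    have hk' := Finset.mem_Icc.1 hk
    have hlt : lam (2 * k) < lam (2 * k + 1) :=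
      hmono ⟨by omega, by omega⟩ ⟨by omega, by omega⟩ (by omega)
    refine (differentiableAt_bandRoot (fun x h1 h2 => hz x ?_) hlt).mul
      (differentiableAt_bandRoot (fun x h1 h2 => hz x ?_) (by linarith))
    · exact Or.inl (Or.inr (Set.mem_biUnion hk ⟨h1, h2⟩))
    · exact Or.inr (Or.inr (Set.mem_biUnion hk ⟨by linarith, by linarith⟩))

theorem tendsto_bandRoot_upper {a b x : ℝ} (hab : a < b) (ha : x ≠ a) (hb : x ≠ b) :
    Tendsto (bandRoot a b) (𝓝[{z : ℂ | 0 < z.im}] (x : ℂ)) (𝓝 (bandRoot a b x)) := by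
  by_cases hx : a < x ∧ x < b
  · have hxa : (x : ℂ) - a ≠ 0 := by exact_mod_cast sub_ne_zero.2 ha
    have hval : ((x : ℂ) - b) / (x - a) = (((x - b) / (x - a) : ℝ) : ℂ) := by push_cast; rfl
    have hneg : (x - b) / (x - a) < 0 := div_neg_of_neg_of_pos (by linarith) (by linarith)
    have hw0 : ((x : ℂ) - b) / (x - a) ≠ 0 := by
      rw [hval]; exact_mod_cast hneg.ne
    have hcont : Tendsto (fun z : ℂ => (z - b) / (z - a)) (𝓝[{z : ℂ | 0 < z.im}] (x : ℂ))
        (𝓝[{w : ℂ | 0 ≤ w.im}] (((x : ℂ) - b) / (x - a))) := by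
      refine tendsto_nhdsWithin_iff.2 ⟨?_, ?_⟩
      · have hid : Tendsto (fun z : ℂ => z) (𝓝[{z : ℂ | 0 < z.im}] (x : ℂ)) (𝓝 (x : ℂ)) :=
          tendsto_id.mono_left nhdsWithin_le_nhds
        exact (hid.sub_const _).div (hid.sub_const _) hxa
      · filter_upwards [self_mem_nhdsWithin] with z hz
        have hz' : 0 < z.im := hz
        have hn : 0 < Complex.normSq (z - a) := by
          apply Complex.normSq_pos.2
          intro h
          have := congrArg Complex.im h
          simp at this
          linarith
        show 0 ≤ ((z - b) / (z - a)).im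
        rw [Complex.div_im, ← sub_div]
        refine div_nonneg ?_ hn.le
        simp
        nlinarith
    have hlog : Tendsto Complex.log (𝓝[{w : ℂ | 0 ≤ w.im}] (((x : ℂ) - b) / (x - a)))
        (𝓝 (Complex.log (((x : ℂ) - b) / (x - a)))) := by
      rw [hval]
      exact Complex.continuousWithinAt_log_of_re_neg_of_im_zero (by rw [Complex.ofReal_re]; exact hneg)
        (Complex.ofReal_im _)
    have hev : bandRoot a b =ᶠ[𝓝[{z : ℂ | 0 < z.im}] (x : ℂ)] fun z =>
        (z - a) * Complex.exp (Complex.log ((z - b) / (z - a)) * (1 / 2)) := by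
      filter_upwards [self_mem_nhdsWithin] with z hz
      have hz' : 0 < z.im := hz
      have h1 : z - a ≠ 0 := by
        intro h
        have := congrArg Complex.im h
        simp at this
        linarith
      have h2 : z - b ≠ 0 := by
        intro h
        have := congrArg Complex.im h
        simp at this
        linarith
      rw [bandRoot, Complex.cpow_def_of_ne_zero (div_ne_zero h2 h1)]
    have hx' : bandRoot a b x =
        ((x : ℂ) - a) * Complex.exp (Complex.log (((x : ℂ) - b) / (x - a)) * (1 / 2)) := by
      rw [bandRoot, Complex.cpow_def_of_ne_zero hw0]
    rw [hx']
    refine Tendsto.congr' hev.symm ?_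
    have hid : Tendsto (fun z : ℂ => z) (𝓝[{z : ℂ | 0 < z.im}] (x : ℂ)) (𝓝 (x : ℂ)) :=
      tendsto_id.mono_left nhdsWithin_le_nhds
    exact (hid.sub_const _).mul
      ((Complex.continuous_exp.tendsto _).comp ((hlog.comp hcont).mul_const _))
  · refine (differentiableAt_bandRoot (fun y h1 h2 h => hx ?_) hab).continuousAt.tendsto.mono_left
      nhdsWithin_le_nhds
    have hxy : x = y := by exact_mod_cast h
    subst hxy
    exact ⟨lt_of_le_of_ne h1 ha.symm, lt_of_le_of_ne h2 hb⟩

/-- On the real line, away from the branch points, `R` is its own limit from the upper half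
plane. -/
theorem tendsto_root_upper {N : ℕ} {lam : ℕ → ℝ} (hpos : 0 < lam 1)
    (hmono : StrictMonoOn lam (Set.Icc 1 (2 * N + 1))) {x : ℝ} (hx : x ∉ branchPoints N lam) :
    Tendsto (root N lam) (𝓝[{z : ℂ | 0 < z.im}] (x : ℂ)) (𝓝 (root N lam x)) := by
  have hne : ∀ j, 1 ≤ j → j ≤ 2 * N + 1 → x ≠ lam j ∧ x ≠ -lam j := fun j h1 h2 =>
    ⟨fun h => hx ⟨j, Finset.mem_Icc.2 ⟨h1, h2⟩, Or.inl h⟩,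
      fun h => hx ⟨j, Finset.mem_Icc.2 ⟨h1, h2⟩, Or.inr h⟩⟩
  unfold root
  have h1 := hne 1 le_rfl (by omega)
  refine Tendsto.mul ?_ (tendsto_finsetProd _ fun k hk => ?_)
  · exact tendsto_bandRoot_upper (by linarith) (by simpa using h1.2) h1.1
  · have hk' := Finset.mem_Icc.1 hk
    have hlt : lam (2 * k) < lam (2 * k + 1) :=
      hmono ⟨by omega, by omega⟩ ⟨by omega, by omega⟩ (by omega)
    have h2 := hne (2 * k) (by omega) (by omega)
    have h3 := hne (2 * k + 1) (by omega) (by omega)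
    refine (tendsto_bandRoot_upper hlt h2.1 h3.1).mul
      (tendsto_bandRoot_upper (by linarith) (by simpa using h3.2) (by simpa using h2.2))

theorem tendsto_bandRoot_div (a b : ℝ) :
    Tendsto (fun z : ℂ => bandRoot a b z / z) (Bornology.cobounded ℂ) (𝓝 1) := by
  have hinv : Tendsto (fun z : ℂ => z⁻¹) (Bornology.cobounded ℂ) (𝓝 0) :=
    tendsto_inv₀_cobounded
  have hA : Tendsto (fun z : ℂ => 1 - (a : ℂ) * z⁻¹) (Bornology.cobounded ℂ) (𝓝 1) := by
    simpa using (hinv.const_mul (a : ℂ)).const_sub 1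
  have hB : Tendsto (fun z : ℂ => 1 - (b : ℂ) * z⁻¹) (Bornology.cobounded ℂ) (𝓝 1) := by
    simpa using (hinv.const_mul (b : ℂ)).const_sub 1
  have hq := hB.div hA one_ne_zero
  rw [div_one] at hq
  have hc := hA.mul (hq.cpow (tendsto_const_nhds (x := (1 / 2 : ℂ))) (by simp))
  rw [Complex.one_cpow, one_mul] at hc
  refine hc.congr' ?_
  have h0 : ∀ᶠ z : ℂ in Bornology.cobounded ℂ, z ≠ 0 :=
    Bornology.eventually_ne_cobounded 0
  filter_upwards [h0] with z hz
  have e : ∀ c : ℝ, 1 - (c : ℂ) * z⁻¹ = (z - c) / z := fun c => by field_simp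
  simp only [Pi.div_apply, e, bandRoot]
  rw [div_div_div_cancel_right₀ hz]
  ring

/-- `R(z) ∼ z ^ (2 N + 1)` at infinity. -/
theorem tendsto_root_div (N : ℕ) (lam : ℕ → ℝ) :
    Tendsto (fun z : ℂ => root N lam z / z ^ (2 * N + 1)) (Bornology.cobounded ℂ) (𝓝 1) := by
  have h := (tendsto_bandRoot_div (-lam 1) (lam 1)).mul
    (tendsto_finsetProd (Finset.Icc 1 N) fun k _ =>
      (tendsto_bandRoot_div (lam (2 * k)) (lam (2 * k + 1))).mul
        (tendsto_bandRoot_div (-lam (2 * k + 1)) (-lam (2 * k))))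
  simp only [mul_one, Finset.prod_const_one] at h
  refine h.congr fun z => ?_
  simp only [root, div_mul_div_comm, Finset.prod_div_distrib, Finset.prod_const, Nat.card_Icc]
  push_cast
  congr 1
  ring

end

end SolitonCondensate

/-!
Off the branch points, `i P / R` minus its polynomial part `i T` at infinity (`T = 1` for `dp`, and
`T = η²` for `dq` up to the factor `12 / π`) is holomorphic in the upper half plane, tends to zero
at infinity and has boundary values whose real part lives on `Γ`, where the imaginary part is `-T`.
By Cauchy's theorem the Hilbert transform of the real part is minus the imaginary part, which gives
the Hilbert transform equations. Applying Cauchy's theorem instead to the product with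
`log ((z + η) / (z - η))`, whose imaginary part jumps by `π` at `±η`, gives the dispersion relations
up to the integral of `Im (i P / R)` over `[-η, η]`; for `η ∈ Γ` this is a sum of gap integrals
and vanishes. Since `1 / R` is locally in `L^p` for `p < 2` only and the logarithm for `p < ∞`, the
product is integrable through the exponents `3 / 2` and `3`.

Two solutions differ by a polynomial `X E(X²)` with `deg E < N`. Where such a polynomial is real,
each vanishing gap integral forces a zero in the gap, so that `E` has `N` zeros; hence the gap
integrals are an injective, and so bijective, linear function of `E`. In the same way `P` itself has
exactly one positive zero in each gap, which determines the sign of `i P / R` on every band.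
-/

namespace SolitonCondensate

open Asymptotics Bornology Set
open scoped ENNReal

/-! ### Boundary values of functions on the upper half plane -/

theorem locallyIntegrable_abs_sub_rpow (c : ℝ) {α : ℝ} (hα : -1 < α) :
    LocallyIntegrable (fun x : ℝ => |x - c| ^ α) := by
  have h : LocallyIntegrable (fun x : ℝ => |x| ^ α) := by
    refine locallyIntegrable_of_norm_le_rpow (C := 1) (α := -α) (by simp) (by simp; linarith)
      (Eventually.of_forall fun x => ?_) ?_
    · rw [one_mul, neg_neg, Real.norm_eq_abs, Real.norm_eq_abs, abs_of_nonneg (by positivity)]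
    · exact (measurable_id.abs.pow_const α).aestronglyMeasurable
  intro x
  obtain ⟨s, hs, hi⟩ := h (x - c)
  refine ⟨(fun y => y - c) ⁻¹' s, (continuous_sub_right c).continuousAt hs, ?_⟩
  exact ((measurePreserving_sub_right volume c).integrableOn_comp_preimage
    (Homeomorph.subRight c).measurableEmbedding).2 hi

theorem locallyIntegrable_prod_abs_sub_rpow (s : Finset ℝ) {α : ℝ} (hα : -1 < α) :
    LocallyIntegrable (fun x : ℝ => ∏ c ∈ s, |x - c| ^ α) := by
  intro x₀
  set t := s.erase x₀ with ht
  have hopen : IsOpen ((t : Set ℝ)ᶜ) := t.finite_toSet.isClosed.isOpen_compl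
  have hcont : ContinuousOn (fun x : ℝ => ∏ c ∈ t, |x - c| ^ α) (t : Set ℝ)ᶜ := by
    refine continuousOn_finsetProd _ fun c hc => ?_
    refine ContinuousOn.rpow_const (by fun_prop) fun x hx => Or.inl ?_
    rw [abs_ne_zero, sub_ne_zero]
    rintro rfl
    exact hx hc
  have hoff : LocallyIntegrableOn (fun x : ℝ => ∏ c ∈ s, |x - c| ^ α) (t : Set ℝ)ᶜ := by
    by_cases hx : x₀ ∈ s
    · simp_rw [← Finset.prod_erase_mul s _ hx]
      exact ((locallyIntegrable_abs_sub_rpow x₀ hα).locallyIntegrableOn _).continuousOn_mul hcont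
        hopen.isLocallyClosed
    · rw [ht, Finset.erase_eq_of_notMem hx] at hcont hopen ⊢
      exact hcont.locallyIntegrableOn hopen.measurableSet
  have hx₀ := hoff x₀ (by simp [ht])
  rwa [hopen.nhdsWithin_eq (by simp [ht])] at hx₀

theorem memLp_prod_abs_sub_rpow (s : Finset ℝ) {α : ℝ} {p : ℝ≥0∞} (hp : p ≠ ∞)
    (hα : -1 < α * p.toReal) {K : Set ℝ} (hK : IsCompact K) :
    MemLp (fun x : ℝ => ∏ c ∈ s, |x - c| ^ α) p (volume.restrict K) := by
  have hmeas : Measurable fun x : ℝ => ∏ c ∈ s, |x - c| ^ α := by fun_prop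
  rcases eq_or_ne p 0 with rfl | hp₀
  · exact memLp_zero_iff_aestronglyMeasurable.2 hmeas.aestronglyMeasurable
  rw [← integrable_norm_rpow_iff hmeas.aestronglyMeasurable hp₀ hp]
  refine ((locallyIntegrable_prod_abs_sub_rpow s hα).integrableOn_isCompact hK).congr
    (Eventually.of_forall fun x => ?_)
  simp only [norm_prod, Real.norm_of_nonneg (Real.rpow_nonneg (abs_nonneg _) _)]
  rw [← Real.finsetProd_rpow _ _ fun c _ => Real.rpow_nonneg (abs_nonneg _) _]
  exact Finset.prod_congr rfl fun c _ => Real.rpow_mul (abs_nonneg _) _ _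

/-- A function on the upper half plane that has boundary values almost everywhere on the real line
and is dominated, on each bounded part of the half plane, by an `L^p` function of the real part.
The boundary values are recorded as the values of `g` itself on the real line. -/
structure HasLpBoundary (p : ℝ≥0∞) (g : ℂ → ℂ) : Prop where
  differentiableOn : DifferentiableOn ℂ g {z | 0 < z.im}
  dominated : ∀ B : ℝ, ∃ G : ℝ → ℝ, MemLp G p (volume.restrict (Icc (-B) B)) ∧
    ∀ᵐ x : ℝ ∂volume.restrict (Icc (-B) B), ∀ δ ∈ Ioc 0 B, ‖g (x + δ * Complex.I)‖ ≤ G x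
  tendsto : ∀ᵐ x : ℝ, Tendsto (fun δ : ℝ => g (x + δ * Complex.I)) (𝓝[>] 0) (𝓝 (g x))

theorem tendsto_ofReal_add_mul_I (x : ℝ) :
    Tendsto (fun δ : ℝ => (x + δ * Complex.I : ℂ)) (𝓝[>] 0) (𝓝[{z | 0 < z.im}] x) := by
  refine tendsto_nhdsWithin_iff.2 ⟨?_, ?_⟩
  · have hcont : Continuous fun δ : ℝ => (x + δ * Complex.I : ℂ) := by fun_prop
    simpa using hcont.continuousAt.tendsto.mono_left (nhdsWithin_le_nhds (a := (0 : ℝ)))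
  · filter_upwards [self_mem_nhdsWithin] with δ hδ
    simpa using hδ

theorem exists_norm_div_sub_le {g : ℂ → ℂ} {s : Set ℂ} {ξ : ℂ}
    (hξ : g =O[𝓝[s] ξ] fun z => z - ξ) :
    ∃ C ρ : ℝ, 0 < ρ ∧ ∀ z ∈ s, ‖g z / (z - ξ)‖ ≤ C + ρ⁻¹ * ‖g z‖ := by
  obtain ⟨C, hC, hbound⟩ := hξ.exists_nonneg
  obtain ⟨ρ, hρ, hball⟩ := Metric.mem_nhdsWithin_iff.1 hbound.bound
  refine ⟨C, ρ, hρ, fun z hz => ?_⟩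
  rw [norm_div]
  rcases lt_or_ge ‖z - ξ‖ ρ with hnear | hfar
  · have hgC : ‖g z‖ ≤ C * ‖z - ξ‖ := hball ⟨mem_ball_iff_norm.2 hnear, hz⟩
    exact (div_le_of_le_mul₀ (norm_nonneg _) hC hgC).trans (le_add_of_nonneg_right (by positivity))
  · rw [inv_mul_eq_div]
    exact (div_le_div_of_nonneg_left (norm_nonneg _) hρ hfar).trans (le_add_of_nonneg_left hC)

namespace HasLpBoundary

variable {p q r : ℝ≥0∞} {f g : ℂ → ℂ}

theorem of_continuousOn (hd : DifferentiableOn ℂ g {z | 0 < z.im})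
    (hc : ContinuousOn g {z | 0 ≤ z.im}) : HasLpBoundary p g where
  differentiableOn := hd
  dominated B := by
    have hK : IsCompact (Icc (-B) B ×ℂ Icc 0 B) := isCompact_Icc.reProdIm isCompact_Icc
    obtain ⟨C, hC⟩ := hK.exists_bound_of_continuousOn (hc.mono fun z hz => hz.2.1)
    refine ⟨fun _ => C, memLp_const C,
      ae_restrict_of_forall_mem measurableSet_Icc fun x hx δ hδ => ?_⟩
    exact hC _ (by simpa [Complex.mem_reProdIm] using ⟨hx, hδ.1.le, hδ.2⟩)
  tendsto := Eventually.of_forall fun x =>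
    ((hc x (by simp)).mono fun _ hz => mem_ofPred.2 (le_of_lt hz)).tendsto.comp
      (tendsto_ofReal_add_mul_I x)

theorem mono_exponent (hg : HasLpBoundary q g) (hpq : p ≤ q) : HasLpBoundary p g where
  differentiableOn := hg.differentiableOn
  dominated B := by
    obtain ⟨G, hG, hle⟩ := hg.dominated B
    exact ⟨G, hG.mono_exponent hpq, hle⟩
  tendsto := hg.tendsto

theorem sub (hf : HasLpBoundary p f) (hg : HasLpBoundary p g) :
    HasLpBoundary p fun z => f z - g z where
  differentiableOn := hf.differentiableOn.sub hg.differentiableOn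
  dominated B := by
    obtain ⟨F, hF, hfF⟩ := hf.dominated B
    obtain ⟨G, hG, hgG⟩ := hg.dominated B
    refine ⟨F + G, hF.add hG, ?_⟩
    filter_upwards [hfF, hgG] with x hx₁ hx₂ δ hδ
    exact (norm_sub_le _ _).trans (add_le_add (hx₁ δ hδ) (hx₂ δ hδ))
  tendsto := by
    filter_upwards [hf.tendsto, hg.tendsto] with x hx₁ hx₂ using hx₁.sub hx₂

theorem mul [p.HolderTriple q r] (hf : HasLpBoundary p f) (hg : HasLpBoundary q g) :
    HasLpBoundary r fun z => f z * g z where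
  differentiableOn := hf.differentiableOn.mul hg.differentiableOn
  dominated B := by
    obtain ⟨F, hF, hfF⟩ := hf.dominated B
    obtain ⟨G, hG, hgG⟩ := hg.dominated B
    refine ⟨F * G, hG.mul hF, ?_⟩
    filter_upwards [hfF, hgG] with x hx₁ hx₂ δ hδ
    rw [norm_mul]
    exact mul_le_mul (hx₁ δ hδ) (hx₂ δ hδ) (norm_nonneg _) ((norm_nonneg _).trans (hx₁ δ hδ))
  tendsto := by
    filter_upwards [hf.tendsto, hg.tendsto] with x hx₁ hx₂ using hx₁.mul hx₂

theorem continuous_horizontal (hg : HasLpBoundary p g) {δ : ℝ} (hδ : 0 < δ) :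
    Continuous fun x : ℝ => g (x + δ * Complex.I) :=
  hg.differentiableOn.continuousOn.comp_continuous (by fun_prop) fun x => by simpa using hδ

theorem aestronglyMeasurable (hg : HasLpBoundary p g) :
    AEStronglyMeasurable (fun x : ℝ => g x) volume := by
  obtain ⟨v, -, hv₀, hv⟩ := exists_seq_strictAnti_tendsto (0 : ℝ)
  refine aestronglyMeasurable_of_tendsto_ae atTop
    (fun n => (hg.continuous_horizontal (hv₀ n)).aestronglyMeasurable) ?_
  filter_upwards [hg.tendsto] with x hx
  exact hx.comp (tendsto_nhdsWithin_iff.2 ⟨hv, Eventually.of_forall hv₀⟩)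

theorem memLp (hg : HasLpBoundary p g) {B : ℝ} (hB : 0 < B) :
    MemLp (fun x : ℝ => g x) p (volume.restrict (Icc (-B) B)) := by
  obtain ⟨G, hG, hle⟩ := hg.dominated B
  refine hG.mono' hg.aestronglyMeasurable.restrict ?_
  filter_upwards [hle, ae_restrict_of_ae hg.tendsto] with x hx hlim
  refine le_of_tendsto hlim.norm ?_
  filter_upwards [Ioc_mem_nhdsGT hB] with δ hδ using hx δ hδ

theorem locallyIntegrable (hg : HasLpBoundary 1 g) : LocallyIntegrable fun x : ℝ => g x := by
  intro x
  have hB : 0 < |x| + 1 := by positivity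
  refine ⟨Icc (-(|x| + 1)) (|x| + 1), Icc_mem_nhds ?_ ?_, memLp_one_iff_integrable.1 (hg.memLp hB)⟩
  · linarith [neg_abs_le x]
  · linarith [le_abs_self x]

theorem intervalIntegrable (hg : HasLpBoundary 1 g) (a b : ℝ) :
    IntervalIntegrable (fun x : ℝ => g x) volume a b :=
  (hg.locallyIntegrable.integrableOn_isCompact isCompact_uIcc).intervalIntegrable

theorem div_sub_of_isBigO (hg : HasLpBoundary p g) {ξ : ℝ}
    (hξ : g =O[𝓝[{z | 0 < z.im}] (ξ : ℂ)] fun z => z - ξ) :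
    HasLpBoundary p fun z => g z / (z - ξ) where
  differentiableOn := by
    refine hg.differentiableOn.div (by fun_prop) fun z hz h => ?_
    simp [sub_eq_zero.1 h] at hz
  dominated B := by
    obtain ⟨G, hG, hle⟩ := hg.dominated B
    obtain ⟨C, ρ, hρ, hquot⟩ := exists_norm_div_sub_le hξ
    refine ⟨fun x => C + ρ⁻¹ * G x, (memLp_const C).add (hG.const_mul ρ⁻¹), ?_⟩
    filter_upwards [hle] with x hx δ hδ
    calc ‖g (x + δ * Complex.I) / (x + δ * Complex.I - ξ)‖
        ≤ C + ρ⁻¹ * ‖g (x + δ * Complex.I)‖ := hquot _ (by simpa using hδ.1)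
      _ ≤ C + ρ⁻¹ * G x := by gcongr; exact hx δ hδ
  tendsto := by
    filter_upwards [hg.tendsto, compl_mem_ae_iff.2 (measure_singleton ξ)] with x hx hxξ
    have hne : (x : ℂ) - ξ ≠ 0 := by exact_mod_cast sub_ne_zero.2 hxξ
    exact hx.div (((tendsto_ofReal_add_mul_I x).mono_right nhdsWithin_le_nhds).sub_const _) hne

theorem norm_integral_horizontal_le (hg : HasLpBoundary p g) {ξ A M δ : ℝ} (hδ : δ ∈ Ioc 0 A)
    (hM : ∀ z : ℂ, 0 < z.im → A ≤ ‖z - ξ‖ → ‖g z‖ ≤ M) :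
    ‖∫ x in (ξ - A)..(ξ + A), g (x + δ * Complex.I)‖ ≤ 4 * A * M := by
  have hA : 0 < A := hδ.1.trans_le hδ.2
  have hM₀ : 0 ≤ M := (norm_nonneg _).trans (hM (ξ + A * Complex.I) (by simpa using hA)
    (by simp [abs_of_pos hA]))
  have hrect := Complex.integral_boundary_rect_eq_zero_of_differentiableOn g ⟨ξ - A, δ⟩ ⟨ξ + A, A⟩
    (hg.differentiableOn.mono fun z hz => by
      have him := hz.2
      rw [mem_preimage, uIcc_of_le hδ.2] at him
      exact hδ.1.trans_le him.1)
  have htop : ‖∫ x in (ξ - A)..(ξ + A), g (x + A * Complex.I)‖ ≤ M * |ξ + A - (ξ - A)| :=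
    intervalIntegral.norm_integral_le_of_norm_le_const fun x _ => hM _ (by simpa using hA)
      ((Complex.abs_im_le_norm _).trans' (by simp [abs_of_pos hA]))
  have hside (c : ℝ) (hc : |c - ξ| = A) :
      ‖Complex.I • ∫ y in δ..A, g (c + y * Complex.I)‖ ≤ M * |A - δ| := by
    rw [norm_smul, Complex.norm_I, one_mul]
    refine intervalIntegral.norm_integral_le_of_norm_le_const fun y hy => hM _ ?_ ?_
    · rw [uIoc_of_le hδ.2] at hy
      simpa using hδ.1.trans hy.1
    · exact (Complex.abs_re_le_norm _).trans' (by simp [hc])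
  have hright := hside (ξ + A) (by simp [abs_of_pos hA])
  have hleft := hside (ξ - A) (by simp [abs_of_pos hA])
  rw [abs_of_nonneg (by linarith)] at htop
  rw [abs_of_nonneg (by linarith [hδ.2])] at hright hleft
  have hbottom : (∫ x in (ξ - A)..(ξ + A), g (x + δ * Complex.I)) =
      (∫ x in (ξ - A)..(ξ + A), g (x + A * Complex.I)) -
        (Complex.I • ∫ y in δ..A, g ((ξ + A : ℝ) + y * Complex.I)) +
        Complex.I • ∫ y in δ..A, g ((ξ - A : ℝ) + y * Complex.I) := by
    linear_combination hrect
  rw [hbottom]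
  refine (norm_add_le _ _).trans ?_
  have hsub := norm_sub_le (∫ x in (ξ - A)..(ξ + A), g (x + A * Complex.I))
    (Complex.I • ∫ y in δ..A, g ((ξ + A : ℝ) + y * Complex.I))
  have := mul_nonneg hM₀ hδ.1.le
  nlinarith

theorem norm_integral_le (hg : HasLpBoundary 1 g) {ξ A M : ℝ} (hA : 0 < A)
    (hM : ∀ z : ℂ, 0 < z.im → A ≤ ‖z - ξ‖ → ‖g z‖ ≤ M) :
    ‖∫ x in (ξ - A)..(ξ + A), g x‖ ≤ 4 * A * M := by
  obtain ⟨G, hG, hle⟩ := hg.dominated (|ξ| + A)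
  have hsub : uIoc (ξ - A) (ξ + A) ⊆ Icc (-(|ξ| + A)) (|ξ| + A) := by
    rw [uIoc_of_le (by linarith)]
    exact Ioc_subset_Icc_self.trans
      (Icc_subset_Icc (by linarith [neg_abs_le ξ]) (by linarith [le_abs_self ξ]))
  have hrestrict := Measure.restrict_mono hsub (le_refl volume)
  have hlim : Tendsto (fun δ : ℝ => ∫ x in (ξ - A)..(ξ + A), g (x + δ * Complex.I)) (𝓝[>] 0)
      (𝓝 (∫ x in (ξ - A)..(ξ + A), g x)) := by
    refine intervalIntegral.tendsto_integral_filter_of_dominated_convergence G ?_ ?_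
      (intervalIntegrable_iff.2 ((memLp_one_iff_integrable.1 hG).mono_measure hrestrict)) ?_
    · filter_upwards [self_mem_nhdsWithin] with δ hδ
      exact (hg.continuous_horizontal hδ).aestronglyMeasurable
    · filter_upwards [Ioc_mem_nhdsGT (show 0 < |ξ| + A by positivity)] with δ hδ
      filter_upwards [(ae_restrict_iff' measurableSet_uIoc).1 (ae_mono hrestrict hle)] with x hx hxA
        using hx hxA δ hδ
    · filter_upwards [hg.tendsto] with x hx _ using hx
  refine le_of_tendsto hlim.norm ?_
  filter_upwards [Ioc_mem_nhdsGT hA] with δ hδ using hg.norm_integral_horizontal_le hδ hM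

theorem tendsto_integral_atTop (hg : HasLpBoundary 1 g)
    (hz : Tendsto (fun z : ℂ => z * g z) (cobounded ℂ ⊓ 𝓟 {z | 0 < z.im}) (𝓝 0)) (ξ : ℝ) :
    Tendsto (fun A : ℝ => ∫ x in (ξ - A)..(ξ + A), g x) atTop (𝓝 0) := by
  rw [Metric.tendsto_nhds]
  intro ε hε
  have hsmall := Metric.tendsto_nhds.1 hz (ε / 16) (by positivity)
  rw [eventually_inf_principal, ← comap_norm_atTop, eventually_comap] at hsmall
  obtain ⟨ρ, hρ⟩ := eventually_atTop.1 hsmall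
  filter_upwards [eventually_ge_atTop (2 * ρ), eventually_gt_atTop (2 * |ξ|)] with A hAρ hAξ
  have hA : 0 < A := (by positivity : 0 ≤ 2 * |ξ|).trans_lt hAξ
  have hM : ∀ z : ℂ, 0 < z.im → A ≤ ‖z - ξ‖ → ‖g z‖ ≤ ε / 8 / A := by
    intro z hz₀ hzA
    have hzξ := norm_sub_le z (ξ : ℂ)
    rw [Complex.norm_real, Real.norm_eq_abs] at hzξ
    have hlt := hρ ‖z‖ (by linarith) z rfl hz₀
    rw [dist_zero_right, norm_mul] at hlt
    rw [le_div_iff₀ hA]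
    nlinarith [norm_nonneg (g z)]
  rw [dist_zero_right]
  calc ‖∫ x in (ξ - A)..(ξ + A), g x‖ ≤ 4 * A * (ε / 8 / A) := hg.norm_integral_le hA hM
    _ = ε / 2 := by field_simp; ring
    _ < ε := half_lt_self hε

end HasLpBoundary

/-! ### The Hilbert transform of a boundary value -/

section Fold

variable {E : Type*} [NormedAddCommGroup E] {F : ℝ → E} {ξ a b : ℝ}

theorem intervalIntegrable_add_comp_sub (hl : IntervalIntegrable F volume (ξ - b) (ξ - a))
    (hr : IntervalIntegrable F volume (ξ + a) (ξ + b)) :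
    IntervalIntegrable (fun t => F (ξ + t) + F (ξ - t)) volume a b := by
  have hr' := hr.comp_add_left ξ
  have hl' := (hl.comp_sub_left ξ).symm
  simp only [add_sub_cancel_left, sub_sub_cancel] at hr' hl'
  exact hr'.add hl'

variable [NormedSpace ℝ E]

theorem integral_add_comp_sub (hl : IntervalIntegrable F volume (ξ - b) (ξ - a))
    (hr : IntervalIntegrable F volume (ξ + a) (ξ + b)) :
    ∫ t in a..b, (F (ξ + t) + F (ξ - t)) =
      (∫ y in (ξ - b)..(ξ - a), F y) + ∫ y in (ξ + a)..(ξ + b), F y := by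
  rw [intervalIntegral.integral_add (by simpa using hr.comp_add_left ξ)
      (by simpa using (hl.comp_sub_left ξ).symm),
    intervalIntegral.integral_comp_add_left, intervalIntegral.integral_comp_sub_left, add_comm]

end Fold

theorem setIntegral_Icc_sdiff_Ioo {F : ℝ → ℂ} {ξ ε A : ℝ} (hε : 0 < ε) (hεA : ε ≤ A)
    (hl : IntervalIntegrable F volume (ξ - A) (ξ - ε))
    (hr : IntervalIntegrable F volume (ξ + ε) (ξ + A)) :
    ∫ y in Icc (ξ - A) (ξ + A) \ Ioo (ξ - ε) (ξ + ε), F y =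
      ∫ t in ε..A, (F (ξ + t) + F (ξ - t)) := by
  have hset : Icc (ξ - A) (ξ + A) \ Ioo (ξ - ε) (ξ + ε) =
      Icc (ξ - A) (ξ - ε) ∪ Icc (ξ + ε) (ξ + A) := by
    ext y
    simp only [Set.mem_sdiff, mem_Icc, mem_Ioo, mem_union]
    grind
  have hdisj : Disjoint (Icc (ξ - A) (ξ - ε)) (Icc (ξ + ε) (ξ + A)) :=
    disjoint_left.2 fun y hy₁ hy₂ => by linarith [hy₁.2, hy₂.1]
  have hl' : ξ - A ≤ ξ - ε := by linarith
  have hr' : ξ + ε ≤ ξ + A := by linarith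
  rw [hset, setIntegral_union hdisj measurableSet_Icc
      ((intervalIntegrable_iff_integrableOn_Icc_of_le hl').1 hl)
      ((intervalIntegrable_iff_integrableOn_Icc_of_le hr').1 hr),
    integral_Icc_eq_integral_Ioc, integral_Icc_eq_integral_Ioc,
    ← intervalIntegral.integral_of_le hl', ← intervalIntegral.integral_of_le hr',
    integral_add_comp_sub hl hr]

theorem hasHilbertTransform_of_intervalIntegrable {G : Set ℝ} {f : ℝ → ℂ} {ξ A : ℝ} (hA : 0 < A)
    (hGA : G ⊆ Icc (ξ - A) (ξ + A)) (hf : LocallyIntegrable f) (hfG : ∀ x ∉ G, f x = 0)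
    (hodd : IntervalIntegrable (fun t : ℝ => (f (ξ + t) - f (ξ - t)) / t) volume 0 A) :
    HasHilbertTransform G f ξ (1 / Real.pi * ∫ t in 0..A, (f (ξ + t) - f (ξ - t)) / t) := by
  have hint {a b : ℝ} (hξ : ξ ∉ uIcc a b) :
      IntervalIntegrable (fun y : ℝ => f y / (y - ξ)) volume a b := by
    simp only [div_eq_mul_inv]
    refine (hf.integrableOn_isCompact isCompact_uIcc).intervalIntegrable.mul_continuousOn ?_
    refine ContinuousOn.inv₀ (by fun_prop) fun y hy => ?_
    exact_mod_cast sub_ne_zero.2 (ne_of_mem_of_not_mem hy hξ)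
  have hfold : ∀ᶠ ε : ℝ in 𝓝[>] 0, ∫ t in ε..A, (f (ξ + t) - f (ξ - t)) / t =
      ∫ y in G \ Ioo (ξ - ε) (ξ + ε), f y / ((y : ℂ) - ξ) := by
    filter_upwards [Ioc_mem_nhdsGT hA] with ε ⟨hε, hεA⟩
    rw [← setIntegral_eq_of_subset_of_forall_sdiff_eq_zero
        (measurableSet_Icc.diff measurableSet_Ioo) (sdiff_subset_sdiff_left hGA)
        fun y hy => by rw [hfG y fun hyG => hy.2 ⟨hyG, hy.1.2⟩, zero_div],
      setIntegral_Icc_sdiff_Ioo hε hεA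
        (hint (notMem_uIcc_of_gt (by linarith) (by linarith)))
        (hint (notMem_uIcc_of_lt (by linarith) (by linarith)))]
    refine intervalIntegral.integral_congr fun t _ => ?_
    push_cast
    rw [add_sub_cancel_left, sub_sub_cancel_left, div_neg, sub_div, sub_eq_add_neg]
  have hcont := intervalIntegral.continuousOn_primitive_interval_left
    (((intervalIntegrable_iff_integrableOn_Icc_of_le hA.le).1 hodd).mono_set
      (uIcc_of_le hA.le).subset) 0 left_mem_uIcc
  have hle : 𝓝[>] (0 : ℝ) ≤ 𝓝[uIcc 0 A] 0 := by
    rw [uIcc_of_le hA.le]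
    exact nhdsWithin_le_of_mem (mem_of_superset (Ioc_mem_nhdsGT hA) Ioc_subset_Icc_self)
  exact ((hcont.mono_left hle).congr' hfold).const_mul _

/-- The Cauchy kernel `g z / (z - ξ)`, with the pole at `ξ` removed at the cost of a function that
is holomorphic on the closed upper half plane and decays at infinity. -/
noncomputable def poleSubtracted (g : ℂ → ℂ) (ξ z : ℂ) : ℂ :=
  (g z - g ξ * (Complex.I / (z - ξ + Complex.I))) / (z - ξ)

theorem tendsto_mul_poleSubtracted {g : ℂ → ℂ} {l : Filter ℂ} (hl : l ≤ cobounded ℂ)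
    (hg : Tendsto g l (𝓝 0)) (ξ : ℂ) : Tendsto (fun z => z * poleSubtracted g ξ z) l (𝓝 0) := by
  have hinv (c : ℂ) : Tendsto (fun z : ℂ => (z - c)⁻¹) (cobounded ℂ) (𝓝 0) :=
    tendsto_inv₀_cobounded.comp (tendsto_sub_const_cobounded c)
  have hpole : Tendsto (fun z : ℂ => g ξ * (Complex.I / (z - ξ + Complex.I))) (cobounded ℂ)
      (𝓝 0) := by
    simpa [div_eq_mul_inv, sub_add] using
      ((hinv (ξ - Complex.I)).const_mul Complex.I).const_mul (g ξ)
  have hratio : Tendsto (fun z : ℂ => 1 + ξ * (z - ξ)⁻¹) (cobounded ℂ) (𝓝 1) := by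
    simpa using ((hinv ξ).const_mul (ξ : ℂ)).const_add 1
  have hprod := (hratio.mono_left hl).mul (hg.sub (hpole.mono_left hl))
  rw [sub_zero, mul_zero] at hprod
  refine hprod.congr' ?_
  filter_upwards [hl (eventually_ne_cobounded ξ)] with z hz
  have := sub_ne_zero.2 hz
  rw [poleSubtracted]
  field_simp
  ring

theorem poleSubtracted_re_add_re (g : ℂ → ℂ) (ξ : ℝ) {t : ℝ} (ht : t ≠ 0) :
    (poleSubtracted g ξ ↑(ξ + t)).re + (poleSubtracted g ξ ↑(ξ - t)).re =
      ((g ↑(ξ + t)).re - (g ↑(ξ - t)).re) / t + 2 * (g ξ).im * (1 + t ^ 2)⁻¹ := by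
  have hre {s : ℝ} (hs : s ≠ 0) : (poleSubtracted g ξ ↑(ξ + s)).re =
      ((g ↑(ξ + s)).re - ((g ξ).re - s * (g ξ).im) / (1 + s ^ 2)) / s := by
    have hpole : Complex.I / (s + Complex.I) = (1 + s * Complex.I) / ((1 + s ^ 2 : ℝ) : ℂ) := by
      have h₁ : (s + Complex.I : ℂ) ≠ 0 := fun h => by simpa using congrArg Complex.im h
      have h₂ : ((1 + s ^ 2 : ℝ) : ℂ) ≠ 0 := by exact_mod_cast (by positivity : 1 + s ^ 2 ≠ 0)
      rw [div_eq_div_iff h₁ h₂]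
      push_cast
      linear_combination (-(s : ℂ)) * Complex.I_sq
    have hsub : ((ξ + s : ℝ) : ℂ) - ξ = s := by push_cast; ring
    rw [poleSubtracted, hsub, hpole, Complex.div_ofReal_re, Complex.sub_re, ← mul_div_assoc,
      Complex.div_ofReal_re]
    simp [mul_comm]
  have hneg := hre (neg_ne_zero.2 ht)
  rw [← sub_eq_add_neg] at hneg
  rw [hre ht, hneg]
  have : 1 + t ^ 2 ≠ 0 := by positivity
  rw [neg_sq]
  field_simp
  ring

namespace HasLpBoundary

variable {g : ℂ → ℂ} {ξ : ℝ}

theorem poleSubtracted (hg : HasLpBoundary 1 g)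
    (hξ : (fun z => g z - g ξ) =O[𝓝[{z | 0 < z.im}] (ξ : ℂ)] fun z => z - ξ) :
    HasLpBoundary 1 (poleSubtracted g ξ) := by
  have hne {z : ℂ} (hz : 0 ≤ z.im) : z - ξ + Complex.I ≠ 0 := fun h => by
    have him := congrArg Complex.im h
    simp only [Complex.add_im, Complex.sub_im, Complex.ofReal_im, Complex.I_im,
      Complex.zero_im] at him
    linarith
  have hpole : HasLpBoundary 1 fun z => g ξ * (Complex.I / (z - ξ + Complex.I)) :=
    of_continuousOn
      (fun z hz => by have := hne (le_of_lt hz); fun_prop (disch := assumption))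
      (fun z hz => by have := hne hz; fun_prop (disch := assumption))
  refine (hg.sub hpole).div_sub_of_isBigO ?_
  have hdiff : DifferentiableAt ℂ (fun z => g ξ * (Complex.I / (z - ξ + Complex.I))) ξ := by
    have := hne (z := ξ) (by simp)
    fun_prop (disch := assumption)
  refine (hξ.sub (hdiff.isBigO_sub.mono nhdsWithin_le_nhds)).congr_left fun z => ?_
  simp

theorem tendsto_integral_odd_part_div (hg : HasLpBoundary 1 g)
    (h₀ : Tendsto g (cobounded ℂ ⊓ 𝓟 {z | 0 < z.im}) (𝓝 0))
    (hξ : (fun z => g z - g ξ) =O[𝓝[{z | 0 < z.im}] (ξ : ℂ)] fun z => z - ξ) :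
    (∀ A, IntervalIntegrable (fun t : ℝ => ((g ↑(ξ + t)).re - (g ↑(ξ - t)).re) / t) volume 0 A) ∧
      Tendsto (fun A : ℝ => ∫ t in 0..A, ((g ↑(ξ + t)).re - (g ↑(ξ - t)).re) / t) atTop
        (𝓝 (-(Real.pi * (g ξ).im))) := by
  have hq := hg.poleSubtracted hξ
  set q : ℝ → ℂ := fun x => SolitonCondensate.poleSubtracted g ξ x
  have hfold (A : ℝ) : IntervalIntegrable (fun t => q (ξ + t) + q (ξ - t)) volume 0 A :=
    intervalIntegrable_add_comp_sub (hq.intervalIntegrable _ _) (hq.intervalIntegrable _ _)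
  have hre (A : ℝ) : IntervalIntegrable (fun t => (q (ξ + t) + q (ξ - t)).re) volume 0 A :=
    ⟨(hfold A).1.re, (hfold A).2.re⟩
  have harctan (A : ℝ) :
      IntervalIntegrable (fun t : ℝ => 2 * (g ξ).im * (1 + t ^ 2)⁻¹) volume 0 A :=
    intervalIntegral.intervalIntegrable_inv_one_add_sq.const_mul _
  have heq (A : ℝ) : EqOn (fun t => (q (ξ + t) + q (ξ - t)).re - 2 * (g ξ).im * (1 + t ^ 2)⁻¹)
      (fun t : ℝ => ((g ↑(ξ + t)).re - (g ↑(ξ - t)).re) / t) (uIoo 0 A) := by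
    intro t ht
    have ht₀ : t ≠ 0 := by rintro rfl; simp at ht
    exact sub_eq_of_eq_add (poleSubtracted_re_add_re g ξ ht₀)
  refine ⟨fun A => ((hre A).sub (harctan A)).congr_uIoo (heq A), ?_⟩
  have hval (A : ℝ) : ∫ t in 0..A, ((g ↑(ξ + t)).re - (g ↑(ξ - t)).re) / t =
      (∫ x in (ξ - A)..(ξ + A), q x).re - 2 * (g ξ).im * Real.arctan A := by
    rw [← intervalIntegral.integral_congr_uIoo (heq A),
      intervalIntegral.integral_sub (hre A) (harctan A), intervalIntegral.integral_const_mul,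
      integral_inv_one_add_sq, Real.arctan_zero, sub_zero]
    have hre_integral := Complex.reCLM.intervalIntegral_comp_comm (hfold A)
    rw [integral_add_comp_sub (hq.intervalIntegrable _ _) (hq.intervalIntegrable _ _), sub_zero,
      add_zero, intervalIntegral.integral_add_adjacent_intervals (hq.intervalIntegrable _ _)
        (hq.intervalIntegrable _ _)] at hre_integral
    exact congrArg (· - 2 * (g ξ).im * Real.arctan A) hre_integral
  simp only [hval]
  have hq₀ := (Complex.continuous_re.tendsto 0).comp
    (hq.tendsto_integral_atTop (tendsto_mul_poleSubtracted inf_le_left h₀ ξ) ξ)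
  have harc := (Real.tendsto_arctan_atTop.mono_right nhdsWithin_le_nhds).const_mul (2 * (g ξ).im)
  have hconst : -(Real.pi * (g ξ).im) = (0 : ℂ).re - 2 * (g ξ).im * (Real.pi / 2) := by
    rw [Complex.zero_re]
    ring
  rw [hconst]
  exact hq₀.sub harc

theorem integral_odd_part_div {G : Set ℝ} {A : ℝ} (hg : HasLpBoundary 1 g)
    (hGA : G ⊆ Icc (ξ - A) (ξ + A)) (hgG : ∀ x : ℝ, x ∉ G → (g x).re = 0)
    (h₀ : Tendsto g (cobounded ℂ ⊓ 𝓟 {z | 0 < z.im}) (𝓝 0))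
    (hξ : (fun z => g z - g ξ) =O[𝓝[{z | 0 < z.im}] (ξ : ℂ)] fun z => z - ξ) :
    ∫ t in 0..A, ((g ↑(ξ + t)).re - (g ↑(ξ - t)).re) / t = -(Real.pi * (g ξ).im) := by
  obtain ⟨hint, hlim⟩ := hg.tendsto_integral_odd_part_div h₀ hξ
  refine tendsto_nhds_unique (tendsto_const_nhds.congr' ?_) hlim
  filter_upwards [eventually_ge_atTop A] with B hB
  have hfar : EqOn (fun t : ℝ => ((g ↑(ξ + t)).re - (g ↑(ξ - t)).re) / t) (fun _ => 0)
      (uIoo A B) := by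
    intro t ht
    rw [uIoo_of_le hB] at ht
    have hr : ξ + t ∉ G := fun h => by linarith [(hGA h).2, ht.1]
    have hl : ξ - t ∉ G := fun h => by linarith [(hGA h).1, ht.1]
    simp only [hgG _ hr, hgG _ hl, sub_zero, zero_div]
  rw [← intervalIntegral.integral_add_adjacent_intervals (hint A) ((hint A).symm.trans (hint B)),
    intervalIntegral.integral_congr_uIoo hfar, intervalIntegral.integral_zero, add_zero]

theorem hasHilbertTransform_re {G : Set ℝ} (hg : HasLpBoundary 1 g) (hG : IsBounded G)
    (hgG : ∀ x : ℝ, x ∉ G → (g x).re = 0)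
    (h₀ : Tendsto g (cobounded ℂ ⊓ 𝓟 {z | 0 < z.im}) (𝓝 0))
    (hξ : (fun z => g z - g ξ) =O[𝓝[{z | 0 < z.im}] (ξ : ℂ)] fun z => z - ξ) :
    HasHilbertTransform G (fun x => ((g x).re : ℂ)) ξ ((-(g ξ).im : ℝ) : ℂ) := by
  obtain ⟨A, hA, hGA⟩ := hG.subset_closedBall_lt 0 ξ
  rw [Real.closedBall_eq_Icc] at hGA
  have hre : LocallyIntegrable fun x : ℝ => ((g x).re : ℂ) := fun x => by
    obtain ⟨s, hs, hi⟩ := hg.locallyIntegrable x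
    exact ⟨s, hs, hi.re.ofReal⟩
  have hint := (hg.tendsto_integral_odd_part_div h₀ hξ).1 A
  have hcast (t : ℝ) : (((g (ξ + t : ℝ)).re : ℂ) - (g (ξ - t : ℝ)).re) / t =
      (((g (ξ + t : ℝ)).re - (g (ξ - t : ℝ)).re) / t : ℝ) := by
    push_cast
    rfl
  have hH := hasHilbertTransform_of_intervalIntegrable hA hGA hre
    (fun x hx => by rw [hgG x hx, Complex.ofReal_zero])
    (by simpa only [hcast] using ⟨hint.1.ofReal, hint.2.ofReal⟩)
  simp only [hcast, intervalIntegral.integral_ofReal, hg.integral_odd_part_div hGA hgG h₀ hξ] at hH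
  convert hH using 1
  push_cast
  field_simp

end HasLpBoundary

/-! ### The logarithmic kernel -/

theorem norm_log_le {z : ℂ} (hz : z ≠ 0) {ε : ℝ} (hε : 0 < ε) :
    ‖Complex.log z‖ ≤ Real.pi + ε⁻¹ * (‖z‖ ^ ε + ‖z⁻¹‖ ^ ε) := by
  have hlog := Real.log_le_rpow_div (norm_nonneg z) hε
  have hlog_inv := Real.log_le_rpow_div (norm_nonneg z⁻¹) hε
  rw [norm_inv, Real.log_inv, ← norm_inv] at hlog_inv
  rw [div_eq_inv_mul] at hlog hlog_inv
  have hre : |Real.log ‖z‖| ≤ ε⁻¹ * (‖z‖ ^ ε + ‖z⁻¹‖ ^ ε) := by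
    rw [mul_add]
    exact abs_le.2 ⟨by linarith [(by positivity : 0 ≤ ε⁻¹ * ‖z‖ ^ ε)],
      by linarith [(by positivity : 0 ≤ ε⁻¹ * ‖z⁻¹‖ ^ ε)]⟩
  have hnorm := Complex.norm_le_abs_re_add_abs_im (Complex.log z)
  rw [Complex.log_re, Complex.log_im] at hnorm
  linarith [Complex.abs_arg_le_pi z]

theorem norm_div_rpow_le {u v : ℂ} {C ε : ℝ} (hu : ‖u‖ ≤ C) (hv : v.re ≠ 0) (hε : 0 ≤ ε) :
    ‖u / v‖ ^ ε ≤ C ^ ε * |v.re| ^ (-ε) := by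
  have hre := abs_pos.2 hv
  have hC := (norm_nonneg u).trans hu
  rw [norm_div, Real.rpow_neg hre.le, ← div_eq_mul_inv, ← Real.div_rpow hC hre.le]
  gcongr
  exact Complex.abs_re_le_norm v

theorem tendsto_log_upper {w : ℂ} (hw : w ≠ 0) :
    Tendsto Complex.log (𝓝[{z | 0 ≤ z.im}] w) (𝓝 (Complex.log w)) := by
  by_cases hslit : w ∈ Complex.slitPlane
  · exact (continuousAt_clog hslit).tendsto.mono_left nhdsWithin_le_nhds
  · rw [Complex.mem_slitPlane_iff, not_or, not_lt, not_not] at hslit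
    exact Complex.continuousWithinAt_log_of_re_neg_of_im_zero
      (hslit.1.lt_of_ne fun h => hw (Complex.ext h hslit.2)) hslit.2

/-- The branch of `log ((z + η) / (z - η))` on the upper half plane whose boundary values are those
taken by the formula on the real line; inverting the argument is what keeps it off the negative
axis, where `Complex.log` is continuous only from above. -/
noncomputable def logKernel (η : ℝ) (z : ℂ) : ℂ := -Complex.log ((z - η) / (z + η))

section LogKernel

variable {η : ℝ}

theorem logKernel_re (η x : ℝ) : (logKernel η x).re = Real.log |(x + η) / (x - η)| := by
  rw [logKernel, Complex.neg_re, Complex.log_re, ← Real.log_inv, ← norm_inv, inv_div]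
  norm_cast

theorem logKernel_im_of_abs_lt {x : ℝ} (hx : |x| < η) : (logKernel η x).im = -Real.pi := by
  have hlt := abs_lt.1 hx
  have hneg : (x - η) / (x + η) < 0 := div_neg_of_neg_of_pos (by linarith) (by linarith)
  rw [logKernel, Complex.neg_im, Complex.log_im]
  exact_mod_cast congrArg Neg.neg (Complex.arg_ofReal_of_neg hneg)

theorem logKernel_im_of_le_abs {x : ℝ} (hη : 0 ≤ η) (hx : η ≤ |x|) : (logKernel η x).im = 0 := by
  have hnonneg : 0 ≤ (x - η) / (x + η) := by
    rcases le_abs.1 hx with h | h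
    · exact div_nonneg (by linarith) (by linarith)
    · exact div_nonneg_of_nonpos (by linarith) (by linarith)
  rw [logKernel, Complex.neg_im, Complex.log_im]
  exact_mod_cast neg_eq_zero.2 (Complex.arg_ofReal_of_nonneg hnonneg)

theorem im_sub_div_add (η : ℝ) (z : ℂ) :
    ((z - η) / (z + η)).im = 2 * η * z.im / Complex.normSq (z + η) := by
  rw [Complex.div_im]
  simp only [Complex.add_re, Complex.add_im, Complex.sub_re, Complex.sub_im, Complex.ofReal_re,
    Complex.ofReal_im, add_zero, sub_zero]
  ring

theorem sub_div_add_mem_slitPlane (hη : 0 ≤ η) {z : ℂ} (hz : 0 < z.im) :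
    (z - η) / (z + η) ∈ Complex.slitPlane := by
  have hne : z + η ≠ 0 := fun h => by simpa [hz.ne'] using congrArg Complex.im h
  rcases hη.eq_or_lt with rfl | hη
  · simp only [Complex.ofReal_zero, add_zero, sub_zero] at hne ⊢
    rw [div_self hne]
    exact Complex.one_mem_slitPlane
  · refine Complex.mem_slitPlane_iff.2 (Or.inr (ne_of_gt ?_))
    rw [im_sub_div_add]
    have := Complex.normSq_pos.2 hne
    positivity

theorem isBigO_mul_logKernel (η : ℝ) :
    (fun z => z * logKernel η z) =O[cobounded ℂ] fun _ => (1 : ℂ) := by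
  have hinv : Tendsto (fun z : ℂ => (z + η)⁻¹) (cobounded ℂ) (𝓝 0) :=
    tendsto_inv₀_cobounded.comp (tendsto_add_const_cobounded (η : ℂ))
  have hratio : (fun z : ℂ => (z - η) / (z + η)) =ᶠ[cobounded ℂ]
      fun z => 1 + (-2 * η) * (z + η)⁻¹ := by
    filter_upwards [eventually_ne_cobounded (-(η : ℂ))] with z hz
    have hne : z + η ≠ 0 := fun h => hz (eq_neg_of_add_eq_zero_left h)
    field_simp
    ring
  have hlim : Tendsto (fun z : ℂ => 1 + (-2 * η) * (z + η)⁻¹) (cobounded ℂ) (𝓝 1) := by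
    simpa using (hinv.const_mul (-2 * (η : ℂ))).const_add 1
  have hlog : logKernel η =O[cobounded ℂ] fun z : ℂ => (-2 * η) * (z + η)⁻¹ := by
    have := (Complex.hasDerivAt_log Complex.one_mem_slitPlane).differentiableAt.isBigO_sub
    refine ((this.comp_tendsto hlim).congr' ?_ ?_).neg_left
    · filter_upwards [hratio] with z hz
      rw [Function.comp_apply, Complex.log_one, sub_zero, hz]
    · exact Eventually.of_forall fun z => add_sub_cancel_left _ _
  have hbound : Tendsto (fun z : ℂ => z * ((-2 * η) * (z + η)⁻¹)) (cobounded ℂ) (𝓝 (-2 * η)) := by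
    have hid : (fun z : ℂ => -2 * η * (1 - η * (z + η)⁻¹)) =ᶠ[cobounded ℂ]
        fun z => z * ((-2 * η) * (z + η)⁻¹) := by
      filter_upwards [eventually_ne_cobounded (-(η : ℂ))] with z hz
      have hne : z + η ≠ 0 := fun h => hz (eq_neg_of_add_eq_zero_left h)
      field_simp
      ring
    simpa using (((hinv.const_mul (η : ℂ)).const_sub 1).const_mul (-2 * (η : ℂ))).congr' hid
  exact ((isBigO_refl (fun z : ℂ => z) _).mul hlog).trans (hbound.isBigO_one ℂ)

theorem norm_logKernel_le {x δ B ε : ℝ} (hx : |x| ≤ B) (hδ : |δ| ≤ B) (hsub : x ≠ η)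
    (hadd : x ≠ -η) (hε : 0 < ε) :
    ‖logKernel η (x + δ * Complex.I)‖ ≤ Real.pi +
      ε⁻¹ * ((2 * B + |η|) ^ ε * |x - -η| ^ (-ε) + (2 * B + |η|) ^ ε * |x - η| ^ (-ε)) := by
  set z : ℂ := x + δ * Complex.I with hz
  have hz_norm : ‖z‖ ≤ 2 * B := by
    refine (norm_add_le _ _).trans ?_
    rw [norm_mul, Complex.norm_I, Complex.norm_real, Complex.norm_real, Real.norm_eq_abs,
      Real.norm_eq_abs]
    linarith
  have hη_norm : ‖(η : ℂ)‖ = |η| := by rw [Complex.norm_real, Real.norm_eq_abs]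
  have hre_sub : (z - η).re = x - η := by simp [hz]
  have hre_add : (z + η).re = x - -η := by simp [hz]
  have hsub₀ : (z - η).re ≠ 0 := by rwa [hre_sub, sub_ne_zero]
  have hadd₀ : (z + η).re ≠ 0 := by rwa [hre_add, sub_ne_zero]
  have hne : (z - η) / (z + η) ≠ 0 :=
    div_ne_zero (fun h => hsub₀ (by rw [h, Complex.zero_re]))
      (fun h => hadd₀ (by rw [h, Complex.zero_re]))
  rw [logKernel, norm_neg]
  refine (norm_log_le hne hε).trans ?_
  rw [inv_div, ← hre_sub, ← hre_add]
  gcongr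
  · exact norm_div_rpow_le ((norm_sub_le _ _).trans (by linarith)) hadd₀ hε.le
  · exact norm_div_rpow_le ((norm_add_le _ _).trans (by linarith)) hsub₀ hε.le

theorem logKernel_hasLpBoundary (hη : 0 ≤ η) {q : ℝ≥0∞} (hq : q ≠ ∞) :
    HasLpBoundary q (logKernel η) where
  differentiableOn z hz := by
    have hne : z + η ≠ 0 := fun h => (ne_of_gt hz) (by simpa using congrArg Complex.im h)
    have hdiv : DifferentiableAt ℂ (fun z : ℂ => (z - η) / (z + η)) z := by
      fun_prop (disch := assumption)
    exact (hdiv.clog (sub_div_add_mem_slitPlane hη hz)).neg.differentiableWithinAt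
  dominated B := by
    obtain ⟨ε, hε, hεq⟩ : ∃ ε : ℝ, 0 < ε ∧ ε * q.toReal < 1 := by
      refine ⟨(q.toReal + 1)⁻¹, by positivity, ?_⟩
      rw [inv_mul_lt_one₀ (by positivity)]
      exact lt_add_one _
    have hpow (c : ℝ) : MemLp (fun x => |x - c| ^ (-ε)) q (volume.restrict (Icc (-B) B)) := by
      simpa using memLp_prod_abs_sub_rpow {c} hq (by linarith) isCompact_Icc
    refine ⟨_, (memLp_const Real.pi).add ((((hpow (-η)).const_mul ((2 * B + |η|) ^ ε)).add
      ((hpow η).const_mul ((2 * B + |η|) ^ ε))).const_mul ε⁻¹), ?_⟩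
    filter_upwards [ae_restrict_mem measurableSet_Icc,
      ae_restrict_of_ae (compl_mem_ae_iff.2 (measure_singleton η)),
      ae_restrict_of_ae (compl_mem_ae_iff.2 (measure_singleton (-η)))] with x hx hsub hadd δ hδ
    exact norm_logKernel_le (abs_le.2 hx) ((abs_of_pos hδ.1).trans_le hδ.2) hsub hadd hε
  tendsto := by
    filter_upwards [compl_mem_ae_iff.2 (measure_singleton η),
      compl_mem_ae_iff.2 (measure_singleton (-η))] with x hx hx'
    have hsub : (x : ℂ) - η ≠ 0 := by exact_mod_cast sub_ne_zero.2 hx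
    have hadd : (x : ℂ) + η ≠ 0 := by exact_mod_cast fun h => hx' (eq_neg_of_add_eq_zero_left h)
    refine ((tendsto_log_upper (div_ne_zero hsub hadd)).comp
      (tendsto_nhdsWithin_iff.2 ⟨?_, ?_⟩)).neg
    · have hx₀ := (tendsto_ofReal_add_mul_I x).mono_right nhdsWithin_le_nhds
      exact (hx₀.sub_const _).div (hx₀.add_const _) hadd
    · filter_upwards [self_mem_nhdsWithin] with δ hδ
      have hδ₀ : (0 : ℝ) ≤ δ := le_of_lt hδ
      refine mem_ofPred.2 ((im_sub_div_add η _).symm ▸ div_nonneg ?_ (Complex.normSq_nonneg _))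
      simp only [Complex.add_im, Complex.ofReal_im, Complex.mul_I_im, Complex.ofReal_re, zero_add]
      positivity

end LogKernel

namespace HasLpBoundary

variable {p q : ℝ≥0∞} {g : ℂ → ℂ} {G : Set ℝ} {η : ℝ}

theorem integrableOn_log_mul_re [p.HolderConjugate q] (hq : q ≠ ∞) (hg : HasLpBoundary p g)
    (hG : IsBounded G) (hη : 0 ≤ η) :
    IntegrableOn (fun x : ℝ => Real.log |(x + η) / (x - η)| * (g x).re) G := by
  obtain ⟨A, hA, hGA⟩ := hG.subset_closedBall_lt 0 0
  rw [Real.closedBall_eq_Icc, zero_sub, zero_add] at hGA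
  have hmul : MemLp (fun x : ℝ => (g x).re * (logKernel η x).re) 1
      (volume.restrict (Icc (-A) A)) :=
    ((logKernel_hasLpBoundary hη hq).memLp hA).re.mul (hg.memLp hA).re
  simp only [logKernel_re, mul_comm (g _).re] at hmul
  exact IntegrableOn.mono_set (memLp_one_iff_integrable.1 hmul) hGA

theorem re_integral_mul_logKernel [p.HolderConjugate q] (hq : q ≠ ∞) (hg : HasLpBoundary p g)
    (hgG : ∀ x : ℝ, x ∉ G → (g x).re = 0) (hη : 0 ≤ η) {A : ℝ}
    (hGA : G ⊆ Ioc (-A) A) (hηA : η ≤ A) :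
    (∫ x in (-A)..A, g x * logKernel η x).re =
      (∫ x in G, Real.log |(x + η) / (x - η)| * (g x).re) +
        Real.pi * ∫ x in (-η)..η, (g x).im := by
  have hA : -A ≤ A := by linarith
  have hre (x : ℝ) : (g x * logKernel η x).re = Real.log |(x + η) / (x - η)| * (g x).re +
      (Ioo (-η) η).indicator (fun x : ℝ => Real.pi * (g x).im) x := by
    rw [Complex.mul_re, logKernel_re]
    by_cases hx : x ∈ Ioo (-η) η
    · rw [indicator_of_mem hx, logKernel_im_of_abs_lt (abs_lt.2 hx)]
      ring
    · rw [indicator_of_notMem hx, logKernel_im_of_le_abs hη (not_lt.1 fun h => hx (abs_lt.1 h))]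
      ring
  have hh : HasLpBoundary 1 fun z => g z * logKernel η z :=
    hg.mul (logKernel_hasLpBoundary hη hq)
  have hlog := hg.integrableOn_log_mul_re hq (Metric.isBounded_Ioc (-A) A) hη
  have him : IntegrableOn ((Ioo (-η) η).indicator fun x : ℝ => Real.pi * (g x).im) (Ioc (-A) A) :=
    (((hh.intervalIntegrable (-A) A).1.re).sub hlog).congr (Eventually.of_forall fun x =>
      sub_eq_of_eq_add' (hre x))
  have hIoo : Ioc (-A) A ∩ Ioo (-η) η = Ioo (-η) η :=
    inter_eq_right.2 fun x hx => ⟨by linarith [hx.1], by linarith [hx.2]⟩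
  rw [← Complex.reCLM_apply, ← Complex.reCLM.intervalIntegral_comp_comm
    (hh.intervalIntegrable _ _), intervalIntegral.integral_of_le hA]
  simp only [Complex.reCLM_apply, hre]
  rw [integral_add hlog him, setIntegral_indicator measurableSet_Ioo, hIoo, integral_const_mul,
    ← integral_Ioc_eq_integral_Ioo, ← intervalIntegral.integral_of_le (neg_le_self hη),
    setIntegral_eq_of_subset_of_forall_sdiff_eq_zero measurableSet_Ioc hGA
      fun x hx => by rw [hgG x hx.2, mul_zero]]

theorem setIntegral_log_mul_re [p.HolderConjugate q] (hq : q ≠ ∞) (hg : HasLpBoundary p g)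
    (hG : IsBounded G) (hgG : ∀ x : ℝ, x ∉ G → (g x).re = 0)
    (h₀ : Tendsto g (cobounded ℂ ⊓ 𝓟 {z | 0 < z.im}) (𝓝 0)) (hη : 0 ≤ η) :
    ∫ x in G, Real.log |(x + η) / (x - η)| * (g x).re =
      -(Real.pi * ∫ x in (-η)..η, (g x).im) := by
  have hh : HasLpBoundary 1 fun z => g z * logKernel η z :=
    hg.mul (logKernel_hasLpBoundary hη hq)
  have hdecay : Tendsto (fun z => z * (g z * logKernel η z)) (cobounded ℂ ⊓ 𝓟 {z | 0 < z.im})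
      (𝓝 0) := by
    have hsmall := ((isLittleO_one_iff ℂ).2 h₀).mul_isBigO
      ((isBigO_mul_logKernel η).mono inf_le_left)
    rw [mul_one, isLittleO_one_iff] at hsmall
    exact hsmall.congr fun z => mul_left_comm _ _ _
  have hlim := (Complex.continuous_re.tendsto 0).comp (hh.tendsto_integral_atTop hdecay 0)
  obtain ⟨B, hGB⟩ := hG.subset_closedBall 0
  rw [Real.closedBall_eq_Icc, zero_sub, zero_add] at hGB
  refine eq_neg_of_add_eq_zero_left (tendsto_nhds_unique (tendsto_const_nhds.congr' ?_) hlim)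
  filter_upwards [eventually_gt_atTop B, eventually_ge_atTop η] with A hA hηA
  rw [Function.comp_apply, zero_sub, zero_add]
  exact (hg.re_integral_mul_logKernel hq hgG hη
    (fun x hx => ⟨by linarith [(hGB hx).1], (hGB hx).2.trans hA.le⟩) hηA).symm

end HasLpBoundary

/-! ### Values of the root on the real line -/

theorem ofReal_cpow_half_of_nonneg {t : ℝ} (ht : 0 ≤ t) : (t : ℂ) ^ (1 / 2 : ℂ) = √t := by
  rw [Real.sqrt_eq_rpow, Complex.ofReal_cpow ht]
  norm_num

theorem ofReal_cpow_half_of_nonpos {t : ℝ} (ht : t ≤ 0) :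
    (t : ℂ) ^ (1 / 2 : ℂ) = Complex.I * √(-t) := by
  rw [Complex.ofReal_cpow_of_nonpos ht, ← Complex.ofReal_neg,
    ofReal_cpow_half_of_nonneg (by linarith), mul_comm,
    show (Real.pi : ℂ) * Complex.I * (1 / 2) = Real.pi / 2 * Complex.I by ring,
    Complex.exp_pi_div_two_mul_I]

section bandRoot

variable {a b x : ℝ}

theorem bandRoot_ofReal (a b x : ℝ) :
    bandRoot a b x = ((x - a : ℝ) : ℂ) * (((x - b) / (x - a) : ℝ) : ℂ) ^ (1 / 2 : ℂ) := by
  simp only [bandRoot, Complex.ofReal_sub, Complex.ofReal_div]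

theorem mul_sqrt_div {p q : ℝ} (hp : 0 < p) : p * √(q / p) = √(p * q) := by
  rw [show p * q = p ^ 2 * (q / p) by field_simp, Real.sqrt_mul (sq_nonneg p), Real.sqrt_sq hp.le]

theorem bandRoot_of_ge (hab : a < b) (hx : b ≤ x) : bandRoot a b x = √((x - a) * (x - b)) := by
  have h : 0 < x - a := by linarith
  rw [bandRoot_ofReal, ofReal_cpow_half_of_nonneg (div_nonneg (by linarith) h.le),
    ← Complex.ofReal_mul, mul_sqrt_div h]

theorem bandRoot_of_le (hab : a < b) (hx : x ≤ a) : bandRoot a b x = -√((a - x) * (b - x)) := by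
  rcases hx.eq_or_lt with rfl | hx
  · simp [bandRoot]
  have h : 0 < a - x := by linarith
  rw [bandRoot_ofReal, ← neg_sub b x, ← neg_sub a x, neg_div_neg_eq,
    ofReal_cpow_half_of_nonneg (div_nonneg (by linarith) h.le),
    ← Complex.ofReal_mul, neg_mul, mul_sqrt_div h, Complex.ofReal_neg]

theorem bandRoot_of_mem (ha : a ≤ x) (hb : x ≤ b) :
    bandRoot a b x = Complex.I * √((x - a) * (b - x)) := by
  rcases ha.eq_or_lt with rfl | ha
  · simp [bandRoot]
  have h : 0 < x - a := by linarith
  rw [bandRoot_ofReal,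
    ofReal_cpow_half_of_nonpos (div_nonpos_of_nonpos_of_nonneg (by linarith) h.le),
    mul_left_comm, ← Complex.ofReal_mul, ← neg_div, neg_sub, mul_sqrt_div h]

theorem bandRoot_neg (hab : a < b) (x : ℝ) :
    bandRoot (-b) (-a) (-x : ℝ) = -starRingEnd ℂ (bandRoot a b x) := by
  rcases le_total x a with hxa | hxa
  · rw [bandRoot_of_le hab hxa, bandRoot_of_ge (by linarith) (by linarith)]
    simp [neg_add_eq_sub, mul_comm]
  rcases le_total x b with hxb | hxb
  · rw [bandRoot_of_mem hxa hxb, bandRoot_of_mem (by linarith) (by linarith)]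
    simp [neg_add_eq_sub, mul_comm]
  · rw [bandRoot_of_ge hab hxb, bandRoot_of_le (by linarith) (by linarith)]
    simp [neg_add_eq_sub, mul_comm]

/-- The product of the branches belonging to the bands `[a, b]` and `[-b, -a]`. -/
noncomputable def pairRoot (a b : ℝ) (z : ℂ) : ℂ := bandRoot a b z * bandRoot (-b) (-a) z

theorem pairRoot_of_le (ha : 0 < a) (hab : a < b) (h0 : 0 ≤ x) (hx : x ≤ a) :
    pairRoot a b x = -√((a ^ 2 - x ^ 2) * (b ^ 2 - x ^ 2)) := by
  rw [pairRoot, bandRoot_of_le hab hx, bandRoot_of_ge (by linarith) (by linarith), neg_mul,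
    ← Complex.ofReal_mul, ← Real.sqrt_mul (by nlinarith)]
  ring_nf

theorem pairRoot_of_ge (ha : 0 < a) (hab : a < b) (hx : b ≤ x) :
    pairRoot a b x = √((x ^ 2 - a ^ 2) * (x ^ 2 - b ^ 2)) := by
  rw [pairRoot, bandRoot_of_ge hab hx, bandRoot_of_ge (by linarith) (by linarith),
    ← Complex.ofReal_mul, ← Real.sqrt_mul (by nlinarith)]
  ring_nf

theorem pairRoot_of_mem (ha : 0 < a) (hab : a < b) (hx : a ≤ x) (hx' : x ≤ b) :
    pairRoot a b x = Complex.I * √((x ^ 2 - a ^ 2) * (b ^ 2 - x ^ 2)) := by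
  rw [pairRoot, bandRoot_of_mem hx hx', bandRoot_of_ge (by linarith) (by linarith), mul_assoc,
    ← Complex.ofReal_mul, ← Real.sqrt_mul (by nlinarith)]
  ring_nf

theorem conj_pairRoot (ha : 0 < a) (hab : a < b) (h0 : 0 ≤ x) (hx : x ≤ a ∨ b ≤ x) :
    starRingEnd ℂ (pairRoot a b x) = pairRoot a b x := by
  rcases hx with hx | hx
  · rw [pairRoot_of_le ha hab h0 hx, map_neg, Complex.conj_ofReal]
  · rw [pairRoot_of_ge ha hab hx, Complex.conj_ofReal]

end bandRoot

theorem root_eq (N : ℕ) (lam : ℕ → ℝ) (z : ℂ) :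
    root N lam z = bandRoot (-lam 1) (lam 1) z *
      ∏ k ∈ Finset.Icc 1 N, pairRoot (lam (2 * k)) (lam (2 * k + 1)) z := rfl

theorem mem_bandsPos {N : ℕ} {lam : ℕ → ℝ} {x : ℝ} :
    x ∈ bandsPos N lam ↔ (0 ≤ x ∧ x ≤ lam 1) ∨
      ∃ k ∈ Finset.Icc 1 N, lam (2 * k) ≤ x ∧ x ≤ lam (2 * k + 1) := by
  simp only [bandsPos, mem_union, mem_iUnion₂, mem_Icc, exists_prop]

theorem neg_mem_bands_iff {N : ℕ} {lam : ℕ → ℝ} {x : ℝ} :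
    -x ∈ bands N lam ↔ x ∈ bands N lam := by
  simp only [bands, mem_union, mem_ofPred_eq, neg_neg]
  exact or_comm

section root

variable {N : ℕ} {lam : ℕ → ℝ} {x : ℝ}

theorem lam_le (hmono : StrictMonoOn lam (Icc 1 (2 * N + 1))) {i j : ℕ}
    (h1 : 1 ≤ i) (h : i ≤ j) (h2 : j ≤ 2 * N + 1) : lam i ≤ lam j :=
  hmono.monotoneOn ⟨h1, by omega⟩ ⟨by omega, h2⟩ h

theorem lam_lt (hmono : StrictMonoOn lam (Icc 1 (2 * N + 1))) {i j : ℕ}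
    (h1 : 1 ≤ i) (h : i < j) (h2 : j ≤ 2 * N + 1) : lam i < lam j :=
  hmono ⟨h1, by omega⟩ ⟨by omega, h2⟩ h

variable (hpos : 0 < lam 1) (hmono : StrictMonoOn lam (Icc 1 (2 * N + 1)))

include hpos hmono

theorem lam_pos {j : ℕ} (h1 : 1 ≤ j) (h2 : j ≤ 2 * N + 1) : 0 < lam j :=
  hpos.trans_le (lam_le hmono le_rfl h1 h2)

theorem lam_band {k : ℕ} (hk : k ∈ Finset.Icc 1 N) :
    0 < lam (2 * k) ∧ lam (2 * k) < lam (2 * k + 1) := by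
  have := Finset.mem_Icc.1 hk
  exact ⟨lam_pos hpos hmono (by omega) (by omega), lam_lt hmono (by omega) (by omega) (by omega)⟩

theorem bandsPos_subset_Icc : bandsPos N lam ⊆ Icc 0 (lam (2 * N + 1)) := by
  intro x hx
  rcases mem_bandsPos.1 hx with h | ⟨k, hk, h⟩
  · exact ⟨h.1, h.2.trans (lam_le hmono le_rfl (by omega) le_rfl)⟩
  · have := Finset.mem_Icc.1 hk
    exact ⟨(lam_band hpos hmono hk).1.le.trans h.1,
      h.2.trans (lam_le hmono (by omega) (by omega) le_rfl)⟩

omit hpos in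
theorem le_or_ge_of_mem_band {k j : ℕ} (hk : k ∈ Finset.Icc 1 N) (hj : j ∈ Finset.Icc 1 N)
    (hjk : j ≠ k) (hx : lam (2 * k) ≤ x ∧ x ≤ lam (2 * k + 1)) :
    x ≤ lam (2 * j - 1) ∨ lam (2 * j + 1) ≤ x := by
  rw [Finset.mem_Icc] at hk hj
  rcases lt_or_gt_of_ne hjk with h | h
  · exact Or.inr ((lam_le hmono (by omega) (by omega) (by omega)).trans hx.1)
  · exact Or.inl (hx.2.trans (lam_le hmono (by omega) (by omega) (by omega)))

theorem root_neg (x : ℝ) : root N lam (-x : ℝ) = -starRingEnd ℂ (root N lam x) := by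
  have hpair : ∀ k ∈ Finset.Icc 1 N, pairRoot (lam (2 * k)) (lam (2 * k + 1)) (-x : ℝ) =
      starRingEnd ℂ (pairRoot (lam (2 * k)) (lam (2 * k + 1)) x) := fun k hk => by
    have hlt := (lam_band hpos hmono hk).2
    have h := bandRoot_neg (neg_lt_neg hlt) x
    rw [neg_neg, neg_neg] at h
    rw [pairRoot, pairRoot, bandRoot_neg hlt, h, map_mul, neg_mul_neg, mul_comm]
  have h1 := bandRoot_neg (show -lam 1 < lam 1 by linarith) x
  rw [neg_neg] at h1
  rw [root_eq, root_eq, h1, Finset.prod_congr rfl hpair, map_mul, map_prod, neg_mul]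

theorem conj_root_of_mem_bandsPos (hx : x ∈ bandsPos N lam) :
    starRingEnd ℂ (root N lam x) = -root N lam x := by
  have hx0 := (bandsPos_subset_Icc hpos hmono hx).1
  rw [root_eq, map_mul, map_prod]
  rcases mem_bandsPos.1 hx with h | ⟨k, hk, h⟩
  · rw [bandRoot_of_mem (by linarith) h.2, map_mul, Complex.conj_I, Complex.conj_ofReal,
      Finset.prod_congr rfl fun k hk => conj_pairRoot (lam_band hpos hmono hk).1
        (lam_band hpos hmono hk).2 hx0 (.inl (h.2.trans ?_)), neg_mul, neg_mul]
    have := Finset.mem_Icc.1 hk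
    exact lam_le hmono le_rfl (by omega) (by omega)
  · have hk' := Finset.mem_Icc.1 hk
    have hx1 : lam 1 ≤ x := (lam_le hmono le_rfl (by omega) (by omega)).trans h.1
    obtain ⟨ha, hab⟩ := lam_band hpos hmono hk
    have hother (j : ℕ) (hj : j ∈ (Finset.Icc 1 N).erase k) :
        starRingEnd ℂ (pairRoot (lam (2 * j)) (lam (2 * j + 1)) x) =
          pairRoot (lam (2 * j)) (lam (2 * j + 1)) x := by
      obtain ⟨hjk, hj⟩ := Finset.mem_erase.1 hj
      obtain ⟨ha, hab⟩ := lam_band hpos hmono hj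
      exact conj_pairRoot ha hab hx0 ((le_or_ge_of_mem_band hmono hk hj hjk h).imp_left fun h =>
        h.trans (lam_le hmono (by grind) (by omega) (by grind)))
    rw [← Finset.mul_prod_erase _ _ hk, ← Finset.mul_prod_erase _ _ hk,
      Finset.prod_congr rfl hother,
      bandRoot_of_ge (by linarith) hx1, pairRoot_of_mem ha hab h.1 h.2, map_mul, Complex.conj_I,
      Complex.conj_ofReal, Complex.conj_ofReal]
    ring

theorem conj_root_of_notMem_bandsPos (hx0 : 0 ≤ x) (hx : x ∉ bandsPos N lam) :
    starRingEnd ℂ (root N lam x) = root N lam x := by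
  rw [mem_bandsPos] at hx
  push Not at hx
  rw [root_eq, map_mul, map_prod, bandRoot_of_ge (by linarith) (hx.1 hx0).le, Complex.conj_ofReal,
    Finset.prod_congr rfl fun k hk => conj_pairRoot (lam_band hpos hmono hk).1
      (lam_band hpos hmono hk).2 hx0 ?_]
  exact (le_total x (lam (2 * k))).imp_right fun h => (hx.2 k hk h).le

theorem root_re_of_mem_bands (hx : x ∈ bands N lam) : (root N lam x).re = 0 := by
  have key {y : ℝ} (hy : y ∈ bandsPos N lam) : (root N lam y).re = 0 := by
    have := congrArg Complex.re (conj_root_of_mem_bandsPos hpos hmono hy)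
    rw [Complex.conj_re, Complex.neg_re] at this
    linarith
  refine hx.elim key fun h => ?_
  simpa only [root_neg hpos hmono, Complex.neg_re, Complex.conj_re, neg_eq_zero] using key h

theorem root_im_of_notMem_bands (hx : x ∉ bands N lam) : (root N lam x).im = 0 := by
  have key {y : ℝ} (hy0 : 0 ≤ y) (hy : y ∉ bandsPos N lam) : (root N lam y).im = 0 :=
    Complex.conj_eq_iff_im.1 (conj_root_of_notMem_bandsPos hpos hmono hy0 hy)
  rcases le_total 0 x with h0 | h0
  · exact key h0 fun h => hx (Or.inl h)
  · simpa only [root_neg hpos hmono, Complex.neg_im, Complex.conj_im, neg_neg] using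
      key (neg_nonneg.2 h0) fun h => hx (Or.inr h)

end root

section

variable {N : ℕ} {lam : ℕ → ℝ} {x : ℝ}

theorem root_ne_zero {z : ℂ} (hz : ∀ y ∈ branchPoints N lam, z ≠ y) : root N lam z ≠ 0 := by
  rw [← pow_ne_zero_iff two_ne_zero, root_sq, Finset.prod_ne_zero_iff]
  intro j hj h
  rw [sq_sub_sq, mul_eq_zero] at h
  rcases h with h | h
  · exact hz (-lam j) ⟨j, hj, Or.inr rfl⟩ (by push_cast; linear_combination h)
  · exact hz (lam j) ⟨j, hj, Or.inl rfl⟩ (by linear_combination h)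

theorem root_ofReal_ne_zero (hx : x ∉ branchPoints N lam) : root N lam x ≠ 0 :=
  root_ne_zero fun y hy h => hx (by rwa [Complex.ofReal_inj.1 h])

theorem root_ne_zero_of_im_pos {z : ℂ} (hz : 0 < z.im) : root N lam z ≠ 0 :=
  root_ne_zero fun y _ h => by simp [h] at hz

theorem norm_sq_root (z : ℂ) : ‖root N lam z‖ ^ 2 =
    ∏ j ∈ Finset.Icc 1 (2 * N + 1), (‖z - lam j‖ * ‖z + lam j‖) := by
  rw [← norm_pow, root_sq, norm_prod]
  exact Finset.prod_congr rfl fun j _ => by rw [← norm_mul, sq_sub_sq, mul_comm]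

theorem norm_root_le (x δ : ℝ) : ‖root N lam x‖ ≤ ‖root N lam (x + δ * Complex.I)‖ := by
  have key (c : ℝ) : ‖(x : ℂ) + c‖ ≤ ‖(x : ℂ) + δ * Complex.I + c‖ := by
    rw [← Complex.ofReal_add, Complex.norm_real]
    simpa using Complex.abs_re_le_norm ((x : ℂ) + δ * Complex.I + c)
  rw [← sq_le_sq₀ (norm_nonneg _) (norm_nonneg _), norm_sq_root, norm_sq_root]
  refine Finset.prod_le_prod (fun _ _ => by positivity) fun j _ => ?_
  refine mul_le_mul ?_ (key _) (norm_nonneg _) (norm_nonneg _)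
  simpa [sub_eq_add_neg] using key (-lam j)

theorem finite_branchPoints : (branchPoints N lam).Finite := by
  refine ((Finset.Icc 1 (2 * N + 1)).finite_toSet.image lam |>.union
    ((Finset.Icc 1 (2 * N + 1)).finite_toSet.image fun j => -lam j)).subset ?_
  rintro x ⟨j, hj, rfl | rfl⟩
  · exact Or.inl ⟨j, hj, rfl⟩
  · exact Or.inr ⟨j, hj, rfl⟩

theorem ae_notMem_branchPoints : ∀ᵐ x : ℝ, x ∉ branchPoints N lam :=
  measure_eq_zero_iff_ae_notMem.1 (finite_branchPoints.measure_zero volume)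

theorem exists_norm_root_rpow_eq_prod (hpos : 0 < lam 1)
    (hmono : StrictMonoOn lam (Icc 1 (2 * N + 1))) :
    ∃ s : Finset ℝ, ∀ α x : ℝ, ‖root N lam x‖ ^ α = ∏ c ∈ s, |x - c| ^ (α / 2) := by
  set J := Finset.Icc 1 (2 * N + 1) with hJ
  have hinj : InjOn lam J := by simpa [hJ] using hmono.injOn
  have hdisj : Disjoint (J.image lam) (J.image fun j => -lam j) := by
    rw [Finset.disjoint_left]
    intro y hy hy'
    obtain ⟨i, hi, rfl⟩ := Finset.mem_image.1 hy
    obtain ⟨j, hj, h⟩ := Finset.mem_image.1 hy'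
    rw [hJ, Finset.mem_Icc] at hi hj
    linarith [lam_pos hpos hmono hi.1 hi.2, lam_pos hpos hmono hj.1 hj.2]
  refine ⟨J.image lam ∪ J.image (fun j => -lam j), fun α x => ?_⟩
  have hsq : ‖root N lam x‖ ^ α = (‖root N lam x‖ ^ 2) ^ (α / 2) := by
    rw [← Real.rpow_natCast_mul (norm_nonneg _), Nat.cast_ofNat, mul_div_cancel₀ α two_ne_zero]
  rw [hsq, norm_sq_root, Finset.prod_union hdisj, Finset.prod_image hinj,
    Finset.prod_image fun i hi j hj h => hinj hi hj (neg_injective h), ← Finset.prod_mul_distrib,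
    ← Real.finsetProd_rpow _ _ fun _ _ => by positivity]
  refine Finset.prod_congr rfl fun j _ => ?_
  rw [Real.mul_rpow (norm_nonneg _) (norm_nonneg _), ← Complex.ofReal_sub, ← Complex.ofReal_add,
    Complex.norm_real, Complex.norm_real, Real.norm_eq_abs, Real.norm_eq_abs, sub_neg_eq_add]

theorem hasLpBoundary_inv_root (hpos : 0 < lam 1) (hmono : StrictMonoOn lam (Icc 1 (2 * N + 1)))
    {p : ℝ≥0∞} (hp : p < 2) : HasLpBoundary p fun z => (root N lam z)⁻¹ where
  differentiableOn := fun z hz =>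
    ((differentiableAt_root hpos hmono fun y _ h => by simp [h] at hz).inv
      (root_ne_zero_of_im_pos hz)).differentiableWithinAt
  dominated B := by
    obtain ⟨s, hs⟩ := exists_norm_root_rpow_eq_prod hpos hmono
    have hp2 : p.toReal < 2 := by
      simpa using (ENNReal.toReal_lt_toReal hp.ne_top ENNReal.ofNat_ne_top).2 hp
    refine ⟨fun x => ‖root N lam x‖ ^ (-1 : ℝ), ?_, ?_⟩
    · simp only [hs]
      exact memLp_prod_abs_sub_rpow s hp.ne_top (by linarith) isCompact_Icc
    · filter_upwards [ae_restrict_of_ae (ae_notMem_branchPoints (N := N) (lam := lam))]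
        with x hx δ _
      rw [norm_inv, Real.rpow_neg_one]
      exact inv_anti₀ (norm_pos_iff.2 (root_ofReal_ne_zero hx)) (norm_root_le x δ)
  tendsto := by
    filter_upwards [ae_notMem_branchPoints (N := N) (lam := lam)] with x hx
    exact ((tendsto_root_upper hpos hmono hx).comp (tendsto_ofReal_add_mul_I x)).inv₀
      (root_ofReal_ne_zero hx)

theorem isBigO_sub_of_isBigO_sq_sub {l : Filter ℂ} {F : ℂ → ℂ} {ξ c : ℂ} (hc : c ≠ 0)
    (hF : Tendsto F l (𝓝 c)) (h : (fun z => F z ^ 2 - c ^ 2) =O[l] fun z => z - ξ) :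
    (fun z => F z - c) =O[l] fun z => z - ξ := by
  have hne : c + c ≠ 0 := by simpa [← two_mul] using hc
  have hinv : Tendsto (fun z => (F z + c)⁻¹) l (𝓝 (c + c)⁻¹) := (hF.add_const c).inv₀ hne
  have hprod := h.mul (hinv.isBigO_one ℂ)
  simp only [mul_one] at hprod
  refine hprod.congr' ?_ EventuallyEq.rfl
  filter_upwards [(hF.add_const c).eventually_ne hne] with z hz
  field_simp
  ring

theorem isBigO_mul_sub_mul {l : Filter ℂ} {F G : ℂ → ℂ} {ξ c d : ℂ} (hF : Tendsto F l (𝓝 c))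
    (hFc : (fun z => F z - c) =O[l] fun z => z - ξ)
    (hGd : (fun z => G z - d) =O[l] fun z => z - ξ) :
    (fun z => F z * G z - c * d) =O[l] fun z => z - ξ := by
  have h := (hF.isBigO_one ℂ).mul hGd
  simp only [one_mul] at h
  refine (h.add (hFc.const_mul_left d)).congr_left fun z => ?_
  ring

theorem isBigO_inv_root_sub (hpos : 0 < lam 1) (hmono : StrictMonoOn lam (Icc 1 (2 * N + 1)))
    (hx : x ∉ branchPoints N lam) :
    (fun z => (root N lam z)⁻¹ - (root N lam x)⁻¹) =O[𝓝[{z | 0 < z.im}] (x : ℂ)]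
      fun z => z - x := by
  have hR := root_ofReal_ne_zero hx
  have hd : DifferentiableAt ℂ (fun z : ℂ => (root N lam z ^ 2)⁻¹) x := by
    refine DifferentiableAt.inv ?_ (pow_ne_zero 2 hR)
    simp_rw [root_sq]
    fun_prop
  refine isBigO_sub_of_isBigO_sq_sub (inv_ne_zero hR)
    ((tendsto_root_upper hpos hmono hx).inv₀ hR) ?_
  simpa only [inv_pow] using hd.isBigO_sub.mono nhdsWithin_le_nhds

end

/-! ### Bands and gaps -/

theorem conj_eval_ofReal {P : ℂ[X]} (hP : P.map (starRingEnd ℂ) = P) (x : ℝ) :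
    starRingEnd ℂ (P.eval (x : ℂ)) = P.eval (x : ℂ) := by
  conv_rhs => rw [← hP, ← Complex.conj_ofReal, eval_map, eval₂_at_apply]

section bands

variable {N : ℕ} {lam : ℕ → ℝ}

theorem measurableSet_bandsPos : MeasurableSet (bandsPos N lam) :=
  measurableSet_Icc.union (Finset.measurableSet_biUnion _ fun _ _ => measurableSet_Icc)

theorem measurableSet_bands : MeasurableSet (bands N lam) :=
  measurableSet_bandsPos.union (measurableSet_bandsPos.preimage measurable_neg)

variable (hpos : 0 < lam 1) (hmono : StrictMonoOn lam (Icc 1 (2 * N + 1)))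

include hpos hmono

theorem isBounded_bands : IsBounded (bands N lam) := by
  have h := (Metric.isBounded_Icc _ _).subset (bandsPos_subset_Icc hpos hmono)
  exact h.union h.neg

theorem lam_gap {j : ℕ} (hj : j ∈ Finset.Icc 1 N) :
    0 < lam (2 * j - 1) ∧ lam (2 * j - 1) < lam (2 * j) := by
  rw [Finset.mem_Icc] at hj
  exact ⟨lam_pos hpos hmono (by omega) (by omega), lam_lt hmono (by omega) (by omega) (by omega)⟩

theorem mem_bandsPos_of_mem_bands {x : ℝ} (h0 : 0 ≤ x) (hx : x ∈ bands N lam) :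
    x ∈ bandsPos N lam := by
  refine hx.elim id fun h => ?_
  obtain rfl : x = 0 := by linarith [(bandsPos_subset_Icc hpos hmono h).1]
  rwa [mem_ofPred_eq, neg_zero] at h

theorem notMem_bands_of_mem_gap {j : ℕ} (hj : j ∈ Finset.Icc 1 N) {x : ℝ}
    (hx : x ∈ Ioo (lam (2 * j - 1)) (lam (2 * j))) : x ∉ bands N lam := by
  intro hmem
  have h0 := (lam_gap hpos hmono hj).1.le.trans hx.1.le
  rw [Finset.mem_Icc] at hj
  rcases mem_bandsPos.1 (mem_bandsPos_of_mem_bands hpos hmono h0 hmem) with h | ⟨k, hk, h⟩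
  · exact (h.2.trans (lam_le hmono le_rfl (by omega) (by omega))).not_gt hx.1
  · rw [Finset.mem_Icc] at hk
    rcases lt_or_ge k j with hkj | hkj
    · exact (h.2.trans (lam_le hmono (by omega) (by omega) (by omega))).not_gt hx.1
    · exact ((lam_le hmono (by omega) (by omega) (by omega)).trans h.1).not_gt hx.2

theorem lam_mem_bandsPos {j : ℕ} (hj : j ∈ Finset.Icc 1 (2 * N + 1)) :
    lam j ∈ bandsPos N lam := by
  rw [Finset.mem_Icc] at hj
  rcases Nat.even_or_odd' j with ⟨k, rfl | rfl⟩
  · exact mem_bandsPos.2 (.inr ⟨k, Finset.mem_Icc.2 ⟨by omega, by omega⟩, le_rfl,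
      lam_le hmono (by omega) (by omega) (by omega)⟩)
  · rcases Nat.eq_zero_or_pos k with rfl | hk
    · exact mem_bandsPos.2 (.inl ⟨hpos.le, le_rfl⟩)
    · exact mem_bandsPos.2 (.inr ⟨k, Finset.mem_Icc.2 ⟨by omega, by omega⟩,
        lam_le hmono (by omega) (by omega) (by omega), le_rfl⟩)

theorem branchPoints_subset_bands : branchPoints N lam ⊆ bands N lam := by
  rintro x ⟨j, hj, rfl | rfl⟩
  · exact .inl (lam_mem_bandsPos hpos hmono hj)
  · exact neg_mem_bands_iff.2 (.inl (lam_mem_bandsPos hpos hmono hj))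

theorem integral_eq_zero_of_mem_bandsPos {f : ℝ → ℝ} (hf : LocallyIntegrable f)
    (hband : ∀ x ∈ bandsPos N lam, f x = 0)
    (hgap : ∀ j ∈ Finset.Icc 1 N, ∫ x in (lam (2 * j - 1))..(lam (2 * j)), f x = 0)
    {x : ℝ} (hx : x ∈ bandsPos N lam) : ∫ t in 0..x, f t = 0 := by
  have hint (a b : ℝ) : IntervalIntegrable f volume a b :=
    (hf.integrableOn_isCompact isCompact_uIcc).intervalIntegrable
  have hzero {a b : ℝ} (hab : a ≤ b) (hsub : Icc a b ⊆ bandsPos N lam) : ∫ t in a..b, f t = 0 :=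
    intervalIntegral.integral_zero_ae <| .of_forall fun t ht =>
      hband t (hsub (Ioc_subset_Icc_self (uIoc_of_le hab ▸ ht)))
  suffices ∀ k ≤ N, ∀ y ∈ bandsPos N lam, y ≤ lam (2 * k + 1) → ∫ t in 0..y, f t = 0 from
    this N le_rfl x hx (bandsPos_subset_Icc hpos hmono hx).2
  intro k
  induction k with
  | zero =>
    exact fun _ y hy hy1 => hzero (bandsPos_subset_Icc hpos hmono hy).1 fun t ht =>
      mem_bandsPos.2 (.inl ⟨ht.1, ht.2.trans hy1⟩)
  | succ k ih =>
    intro hk y hy hyk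
    rcases le_or_gt y (lam (2 * k + 1)) with hyk' | hyk'
    · exact ih (by omega) y hy hyk'
    have hmem : k + 1 ∈ Finset.Icc 1 N := Finset.mem_Icc.2 ⟨by omega, hk⟩
    have hky : lam (2 * (k + 1)) ≤ y :=
      not_lt.1 fun h => notMem_bands_of_mem_gap hpos hmono hmem ⟨hyk', h⟩ (.inl hy)
    have hend : lam (2 * k + 1) ∈ bandsPos N lam :=
      lam_mem_bandsPos hpos hmono (Finset.mem_Icc.2 ⟨by omega, by omega⟩)
    rw [← intervalIntegral.integral_add_adjacent_intervals (hint 0 (lam (2 * (k + 1)))) (hint _ _),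
      ← intervalIntegral.integral_add_adjacent_intervals (hint 0 (lam (2 * k + 1))) (hint _ _),
      ih (by omega) _ hend le_rfl, show 2 * k + 1 = 2 * (k + 1) - 1 by omega, hgap (k + 1) hmem,
      hzero hky fun t ht => mem_bandsPos.2 (.inr ⟨k + 1, hmem, ht.1, ht.2.trans hyk⟩)]
    simp only [add_zero]

theorem setIntegral_bands_of_even {f : ℝ → ℝ} (hf : ∀ x, f (-x) = f x) :
    ∫ x in bands N lam, f x = 2 * ∫ x in bandsPos N lam, f x := by
  set F := (bands N lam).indicator f with hF
  have hFeven (x : ℝ) : F |x| = F x := by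
    rcases abs_choice x with h | h
    · rw [h]
    · by_cases hx : x ∈ bands N lam <;> simp [h, hF, hx, hf, neg_mem_bands_iff]
  have hpart : (Ioi 0 ∩ bands N lam : Set ℝ) =ᵐ[volume] bandsPos N lam := by
    filter_upwards [compl_mem_ae_iff.2 (measure_singleton (0 : ℝ))] with x hx
    refine propext ⟨fun h => mem_bandsPos_of_mem_bands hpos hmono (le_of_lt h.1) h.2, fun h =>
      ⟨lt_of_le_of_ne (bandsPos_subset_Icc hpos hmono h).1 (Ne.symm hx), .inl h⟩⟩
  rw [← integral_indicator measurableSet_bands, ← hF, ← funext hFeven, integral_comp_abs, hF,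
    setIntegral_indicator measurableSet_bands, setIntegral_congr_set hpart]

end bands

/-! ### The densities `i P / R` -/

/-- The density `i P(z) / R(z)`, of which `dp/dη` and `dq/dη` are the multiples by `1/π` and
`12/π`. -/
noncomputable def density (N : ℕ) (lam : ℕ → ℝ) (P : ℂ[X]) (z : ℂ) : ℂ :=
  Complex.I * P.eval z / root N lam z

section density

variable {N : ℕ} {lam : ℕ → ℝ} {P : ℂ[X]} {x : ℝ}

theorem density_sub (P Q : ℂ[X]) (z : ℂ) :
    density N lam (P - Q) z = density N lam P z - density N lam Q z := by
  simp only [density, eval_sub, mul_sub, sub_div]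

variable (hpos : 0 < lam 1) (hmono : StrictMonoOn lam (Icc 1 (2 * N + 1)))

include hpos hmono

theorem density_neg (hodd : P.comp (-X) = -P) (hreal : P.map (starRingEnd ℂ) = P) (x : ℝ) :
    density N lam P (-x : ℝ) = -starRingEnd ℂ (density N lam P x) := by
  have heval := congrArg (eval (x : ℂ)) hodd
  simp only [eval_comp, eval_neg, eval_X] at heval
  rw [density, density, root_neg hpos hmono, Complex.ofReal_neg, heval, map_div₀, map_mul,
    Complex.conj_I, conj_eval_ofReal hreal, mul_neg, neg_div_neg_eq, neg_mul, neg_div, neg_neg]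

theorem density_im_of_mem_bands (hreal : P.map (starRingEnd ℂ) = P) (hx : x ∈ bands N lam) :
    (density N lam P x).im = 0 := by
  have hP := Complex.conj_eq_iff_im.1 (conj_eval_ofReal hreal x)
  simp [density, Complex.div_im, root_re_of_mem_bands hpos hmono hx, hP]

theorem density_neg_of_mem_bands (hodd : P.comp (-X) = -P) (hreal : P.map (starRingEnd ℂ) = P)
    (hx : x ∈ bands N lam) : density N lam P (-x : ℝ) = -density N lam P x := by
  rw [density_neg hpos hmono hodd hreal,
    Complex.conj_eq_iff_im.2 (density_im_of_mem_bands hpos hmono hreal hx)]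

theorem density_re_of_notMem_bands (hreal : P.map (starRingEnd ℂ) = P) (hx : x ∉ bands N lam) :
    (density N lam P x).re = 0 := by
  have hP := Complex.conj_eq_iff_im.1 (conj_eval_ofReal hreal x)
  simp [density, Complex.div_re, root_im_of_notMem_bands hpos hmono hx, hP]

theorem ofReal_density_re (hreal : P.map (starRingEnd ℂ) = P) (hx : x ∈ bands N lam) :
    ((density N lam P x).re : ℂ) = density N lam P x :=
  Complex.ext rfl (density_im_of_mem_bands hpos hmono hreal hx).symm

theorem hasLpBoundary_density (P : ℂ[X]) {p : ℝ≥0∞} (hp : p < 2) :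
    HasLpBoundary p (density N lam P) := by
  have hpoly : HasLpBoundary ∞ fun z => Complex.I * P.eval z :=
    .of_continuousOn (by fun_prop) (by fun_prop)
  exact hpoly.mul (hasLpBoundary_inv_root hpos hmono hp)

theorem locallyIntegrable_density (P : ℂ[X]) :
    LocallyIntegrable fun x : ℝ => density N lam P x :=
  (hasLpBoundary_density hpos hmono P ENNReal.one_lt_two).locallyIntegrable

theorem integrableOn_density (P : ℂ[X]) :
    IntegrableOn (fun x : ℝ => density N lam P x) (bands N lam) :=
  ((locallyIntegrable_density hpos hmono P).integrableOn_isCompact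
    (isBounded_bands hpos hmono).isCompact_closure).mono_set subset_closure

theorem intervalIntegrable_density (P : ℂ[X]) (a b : ℝ) :
    IntervalIntegrable (fun x : ℝ => density N lam P x) volume a b :=
  IntegrableOn.intervalIntegrable
    ((locallyIntegrable_density hpos hmono P).integrableOn_isCompact isCompact_uIcc)

theorem intervalIntegrable_density_im (P : ℂ[X]) (a b : ℝ) :
    IntervalIntegrable (fun x : ℝ => (density N lam P x).im) volume a b :=
  have h := intervalIntegrable_density hpos hmono P a b
  ⟨h.1.im, h.2.im⟩

theorem integral_density_im_eq_zero (hodd : P.comp (-X) = -P)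
    (hreal : P.map (starRingEnd ℂ) = P) (hgaps : GapIntegralsVanish N lam (density N lam P))
    (hx : x ∈ bandsPos N lam) : ∫ t in (-x)..x, (density N lam P t).im = 0 := by
  have him : LocallyIntegrable fun t : ℝ => (density N lam P t).im := fun t =>
    (locallyIntegrable_density hpos hmono P t).imp fun s hs => ⟨hs.1, hs.2.im⟩
  have hright : ∫ t in 0..x, (density N lam P t).im = 0 := by
    refine integral_eq_zero_of_mem_bandsPos hpos hmono him
      (fun t ht => density_im_of_mem_bands hpos hmono hreal (.inl ht)) (fun j hj => ?_) hx
    simpa [hgaps j hj] using Complex.imCLM.intervalIntegral_comp_comm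
      (intervalIntegrable_density hpos hmono P (lam (2 * j - 1)) (lam (2 * j)))
  have heven (t : ℝ) : (density N lam P (-t : ℝ)).im = (density N lam P t).im := by
    rw [density_neg hpos hmono hodd hreal, Complex.neg_im, Complex.conj_im, neg_neg]
  have hleft : ∫ t in (-x)..0, (density N lam P t).im = 0 := by
    have hcomp := intervalIntegral.integral_comp_neg (a := 0) (b := x)
      fun t : ℝ => (density N lam P t).im
    simpa only [heven, neg_zero, hright] using hcomp.symm
  have hint := intervalIntegrable_density_im hpos hmono P
  rw [← intervalIntegral.integral_add_adjacent_intervals (hint _ 0) (hint _ _), hleft, hright,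
    add_zero]

theorem isBigO_density_sub (P : ℂ[X]) (hx : x ∉ branchPoints N lam) :
    (fun z => density N lam P z - density N lam P x) =O[𝓝[{z | 0 < z.im}] (x : ℂ)]
      fun z => z - x := by
  have hpoly : DifferentiableAt ℂ (fun z => Complex.I * P.eval z) x := by fun_prop
  exact isBigO_mul_sub_mul (hpoly.continuousAt.tendsto.mono_left nhdsWithin_le_nhds)
    (hpoly.isBigO_sub.mono nhdsWithin_le_nhds) (isBigO_inv_root_sub hpos hmono hx)

end density

/-- `i P / R dη` is the normalized differential whose polynomial part at infinity is `i T dη`: the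
numerator `P` is odd, the integrals over the gaps vanish, and no other term that does not vanish at
infinity is left. -/
structure IsNormalized (N : ℕ) (lam : ℕ → ℝ) (T : ℝ[X]) (P : ℂ[X]) : Prop where
  odd : P.comp (-X) = -P
  gaps : GapIntegralsVanish N lam (density N lam P)
  tendsto : Tendsto (fun z => density N lam P z - Complex.I * aeval z T) (cobounded ℂ) (𝓝 0)

theorem three_halves_lt_two : (3 / 2 : ℝ≥0∞) < 2 := by
  rw [ENNReal.div_lt_iff (by simp) (by simp)]
  norm_num

instance holderConjugate_three_halves_three : (3 / 2 : ℝ≥0∞).HolderConjugate 3 := by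
  rw [ENNReal.holderConjugate_iff, ENNReal.inv_div (by simp) (by simp)]
  have h : (2 / 3 : ℝ≥0∞) + 1 / 3 = (2 + 1) / 3 := (ENNReal.add_div).symm
  rw [← one_div, h, two_add_one_eq_three, ENNReal.div_self (by simp) (by simp)]

section residual

variable {N : ℕ} {lam : ℕ → ℝ}

theorem residual_re (P : ℂ[X]) (T : ℝ[X]) (x : ℝ) :
    (density N lam P x - Complex.I * aeval (x : ℂ) T).re = (density N lam P x).re := by
  rw [← Complex.coe_algebraMap, aeval_algebraMap_apply]
  simp

theorem residual_im (P : ℂ[X]) (T : ℝ[X]) (x : ℝ) :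
    (density N lam P x - Complex.I * aeval (x : ℂ) T).im = (density N lam P x).im - T.eval x := by
  rw [← Complex.coe_algebraMap, aeval_algebraMap_apply]
  simp

theorem hasLpBoundary_residual (hpos : 0 < lam 1) (hmono : StrictMonoOn lam (Icc 1 (2 * N + 1)))
    (P : ℂ[X]) (T : ℝ[X]) {p : ℝ≥0∞} (hp : p < 2) :
    HasLpBoundary p fun z => density N lam P z - Complex.I * aeval z T :=
  (hasLpBoundary_density hpos hmono P hp).sub <|
    .of_continuousOn (T.differentiable_aeval.differentiableOn.const_mul _)
      (continuousOn_const.mul T.continuous_aeval.continuousOn)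

theorem isBigO_residual_sub (hpos : 0 < lam 1) (hmono : StrictMonoOn lam (Icc 1 (2 * N + 1)))
    (P : ℂ[X]) (T : ℝ[X]) {x : ℝ} (hx : x ∉ branchPoints N lam) :
    (fun z => density N lam P z - Complex.I * aeval z T -
      (density N lam P x - Complex.I * aeval (x : ℂ) T)) =O[𝓝[{z | 0 < z.im}] (x : ℂ)]
      fun z => z - x := by
  have hT : DifferentiableAt ℂ (fun z => Complex.I * aeval z T) x :=
    T.differentiable_aeval.differentiableAt.const_mul _
  refine ((isBigO_density_sub hpos hmono P hx).sub
    (hT.isBigO_sub.mono nhdsWithin_le_nhds)).congr_left fun z => ?_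
  ring

theorem integrableOn_log_mul_density (hpos : 0 < lam 1)
    (hmono : StrictMonoOn lam (Icc 1 (2 * N + 1))) {P : ℂ[X]} (hreal : P.map (starRingEnd ℂ) = P)
    {η : ℝ} (hη : 0 ≤ η) :
    IntegrableOn (fun x : ℝ => (Real.log |(x + η) / (x - η)| : ℂ) * density N lam P x)
      (bandsPos N lam) := by
  have hG := (isBounded_bands hpos hmono).subset (subset_union_left (s := bandsPos N lam))
  have hint := (hasLpBoundary_density hpos hmono P three_halves_lt_two).integrableOn_log_mul_re
    (q := 3) (by simp) hG hη
  refine IntegrableOn.congr_fun (Integrable.ofReal (𝕜 := ℂ) hint) (fun x hx => ?_)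
    measurableSet_bandsPos
  simp [ofReal_density_re hpos hmono hreal (.inl hx)]

end residual

namespace IsNormalized

variable {N : ℕ} {lam : ℕ → ℝ} {T : ℝ[X]} {P : ℂ[X]} {x η : ℝ}

variable (hpos : 0 < lam 1) (hmono : StrictMonoOn lam (Icc 1 (2 * N + 1)))
  (h : IsNormalized N lam T P) (hreal : P.map (starRingEnd ℂ) = P)

include hpos hmono h hreal

theorem hasHilbertTransform (hx : x ∈ bands N lam \ branchPoints N lam) :
    HasHilbertTransform (bands N lam) (fun y => density N lam P y) x (T.eval x : ℝ) := by
  have hH := (hasLpBoundary_residual hpos hmono P T ENNReal.one_lt_two).hasHilbertTransform_re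
    (isBounded_bands hpos hmono)
    (fun y hy => by rw [residual_re, density_re_of_notMem_bands hpos hmono hreal hy])
    (h.tendsto.mono_left inf_le_left) (isBigO_residual_sub hpos hmono P T hx.2)
  rw [residual_im, density_im_of_mem_bands hpos hmono hreal hx.1, zero_sub, neg_neg] at hH
  refine hH.congr fun ε => congrArg _ (setIntegral_congr_fun
    (measurableSet_bands.diff measurableSet_Ioo) fun y hy => ?_)
  simp only [residual_re, ofReal_density_re hpos hmono hreal hy.1]

theorem setIntegral_bands_log_mul_re (hη : η ∈ bandsPos N lam) :
    ∫ x in bands N lam, Real.log |(x + η) / (x - η)| * (density N lam P x).re =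
      Real.pi * ∫ x in (-η)..η, T.eval x := by
  have hlog := (hasLpBoundary_residual hpos hmono P T three_halves_lt_two).setIntegral_log_mul_re
    (q := 3) (by simp) (isBounded_bands hpos hmono)
    (fun x hx => by rw [residual_re, density_re_of_notMem_bands hpos hmono hreal hx])
    (h.tendsto.mono_left inf_le_left) (bandsPos_subset_Icc hpos hmono hη).1
  simp only [residual_re, residual_im] at hlog
  rw [hlog, intervalIntegral.integral_sub (intervalIntegrable_density_im hpos hmono P _ _)
    (T.continuous.intervalIntegrable _ _),
    integral_density_im_eq_zero hpos hmono h.odd hreal h.gaps hη]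
  ring

theorem setIntegral_log_mul_density (hη : η ∈ bandsPos N lam) :
    ∫ x in bandsPos N lam, (Real.log |(x + η) / (x - η)| : ℂ) * density N lam P x =
      (Real.pi / 2 * ∫ x in (-η)..η, T.eval x : ℝ) := by
  have heven := setIntegral_bands_of_even hpos hmono
    (f := fun x => Real.log |(x + η) / (x - η)| * (density N lam P x).re) fun x => by
      rw [density_neg hpos hmono h.odd hreal, abs_div, abs_div, neg_add_eq_sub, ← neg_add',
        abs_neg, abs_sub_comm, ← inv_div, Real.log_inv]
      simp
  rw [setIntegral_bands_log_mul_re hpos hmono h hreal hη] at heven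
  calc ∫ x in bandsPos N lam, (Real.log |(x + η) / (x - η)| : ℂ) * density N lam P x
    _ = ∫ x in bandsPos N lam,
          ((Real.log |(x + η) / (x - η)| * (density N lam P x).re : ℝ) : ℂ) :=
      setIntegral_congr_fun measurableSet_bandsPos fun x hx => by
        simp [ofReal_density_re hpos hmono hreal (.inl hx)]
    _ = (∫ x in bandsPos N lam, Real.log |(x + η) / (x - η)| * (density N lam P x).re : ℝ) :=
      integral_ofReal
    _ = (Real.pi / 2 * ∫ x in (-η)..η, T.eval x : ℝ) := by
      congr 1
      linarith

theorem solvesNDR_const_mul {c : ℝ} {g : ℝ → ℝ}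
    (hg : ∀ η, c * (Real.pi / 2 * ∫ x in (-η)..η, T.eval x) = g η) :
    SolvesNDR (bandsPos N lam) (fun _ => 0) g fun x => c * density N lam P x := by
  intro η hη
  have hη0 := (bandsPos_subset_Icc hpos hmono hη).1
  rw [← hg, Complex.ofReal_mul, ← setIntegral_log_mul_density hpos hmono h hreal hη,
    ← integral_const_mul]
  simp only [mul_left_comm _ (c : ℂ), Complex.ofReal_zero, mul_zero, add_zero, and_true]
  exact (integrableOn_log_mul_density hpos hmono hreal hη0).const_mul _

end IsNormalized

/-! ### Zeros of the numerator in the gaps -/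

theorem comp_neg_X_coeff {R : Type*} [CommRing R] (P : R[X]) (n : ℕ) :
    (P.comp (-X)).coeff n = (-1) ^ n * P.coeff n := by
  rw [← one_mul X, ← neg_mul, ← C_1, ← C_neg, comp_C_mul_X_coeff, mul_comm]

theorem odd_X_mul_expand {R : Type*} [CommRing R] (E : R[X]) :
    (X * expand R 2 E).comp (-X) = -(X * expand R 2 E) := by
  rw [mul_comp, X_comp, expand_eq_comp_X_pow, comp_assoc, X_pow_comp, neg_sq, neg_mul]

theorem exists_eq_X_mul_expand {R : Type*} [CommRing R] [NoZeroDivisors R] [CharZero R] {P : R[X]}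
    (hP : P.comp (-X) = -P) : ∃ E, P = X * expand R 2 E := by
  have heven (n : ℕ) (hn : Even n) : P.coeff n = 0 := by
    have h := congrArg (coeff · n) hP
    simp only [comp_neg_X_coeff, hn.neg_one_pow, one_mul, coeff_neg] at h
    exact CharZero.eq_neg_self_iff.1 h
  refine ⟨contract 2 P.divX, ext fun n => ?_⟩
  rcases n with - | n
  · simp [heven 0 Even.zero]
  rw [coeff_X_mul, coeff_expand two_pos, coeff_contract two_ne_zero, coeff_divX]
  split_ifs with h
  · rw [Nat.div_mul_cancel h]
  · exact heven _ (by grind)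

section gaps

variable {N : ℕ} {lam : ℕ → ℝ} {P E : ℂ[X]} {x : ℝ} {j : ℕ}

variable (hpos : 0 < lam 1) (hmono : StrictMonoOn lam (Icc 1 (2 * N + 1)))

include hpos hmono

theorem continuousAt_density (P : ℂ[X]) (hx : x ∉ bands N lam) :
    ContinuousAt (density N lam P) x := by
  have hroot : ContinuousAt (root N lam) x :=
    (differentiableAt_root hpos hmono fun y hy h =>
      hx (by rwa [Complex.ofReal_inj.1 h])).continuousAt
  exact (by fun_prop : ContinuousAt (fun z => Complex.I * P.eval z) x).div hroot
    (root_ofReal_ne_zero fun h => hx (branchPoints_subset_bands hpos hmono h))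

theorem density_eq_zero_iff (hx : x ∉ bands N lam) :
    density N lam P x = 0 ↔ P.eval (x : ℂ) = 0 := by
  simp [density,
    root_ofReal_ne_zero fun h => hx (branchPoints_subset_bands hpos hmono h)]

theorem exists_eval_eq_zero_of_gap (hreal : P.map (starRingEnd ℂ) = P)
    (hj : j ∈ Finset.Icc 1 N)
    (h : ∫ x in lam (2 * j - 1)..lam (2 * j), density N lam P (x : ℂ) = 0) :
    ∃ a ∈ Ioo (lam (2 * j - 1)) (lam (2 * j)), P.eval (a : ℂ) = 0 := by
  have hlt := (lam_gap hpos hmono hj).2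
  have hint := intervalIntegrable_density hpos hmono P (lam (2 * j - 1)) (lam (2 * j))
  have hnot {x : ℝ} (hx : x ∈ Ioo (lam (2 * j - 1)) (lam (2 * j))) : x ∉ bands N lam :=
    notMem_bands_of_mem_gap hpos hmono hj hx
  set G := Ioo (lam (2 * j - 1)) (lam (2 * j))
  have hcont : ContinuousOn (fun x : ℝ => (density N lam P x).im) G := fun x hx =>
    (Complex.continuous_im.continuousAt.comp
      ((continuousAt_density hpos hmono P (hnot hx)).comp'
        Complex.continuous_ofReal.continuousAt)).continuousWithinAt
  have hintG : IntegrableOn (fun x : ℝ => density N lam P x) G :=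
    ((intervalIntegrable_iff_integrableOn_Ioo_of_le hlt.le).1 hint)
  have hzero : ∫ x in G, (density N lam P x).im = 0 := by
    rw [← integral_Ioc_eq_integral_Ioo, ← intervalIntegral.integral_of_le hlt.le]
    simpa [h] using Complex.imCLM.intervalIntegral_comp_comm hint
  have hconn : IsConnected G := isConnected_Ioo hlt
  obtain ⟨a, ha, hmean⟩ := exists_eq_const_mul_setIntegral_of_nonneg hconn measurableSet_Ioo hcont
    (integrableOn_const (C := (1 : ℝ)) measure_Ioo_lt_top.ne)
    (by simp only [mul_one]; exact hintG.im) fun _ _ => zero_le_one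
  refine ⟨a, ha, (density_eq_zero_iff hpos hmono (hnot ha)).1 (Complex.ext
    (density_re_of_notMem_bands hpos hmono hreal (hnot ha)) ?_)⟩
  have hvol : volume.real G ≠ 0 := by
    simp [G, Real.volume_real_Ioo_of_le hlt.le, sub_ne_zero, hlt.ne']
  simpa [hzero, hvol] using hmean

theorem injOn_sq_of_mem_gap {a : ℕ → ℝ}
    (ha : ∀ j ∈ Finset.Icc 1 N, a j ∈ Ioo (lam (2 * j - 1)) (lam (2 * j))) :
    InjOn (fun j => (a j : ℂ) ^ 2) (Finset.Icc 1 N) := by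
  have hmonoa : StrictMonoOn a (Finset.Icc 1 N) := fun i hi j hj hij => by
    have hi' := Finset.mem_Icc.1 hi
    have hj' := Finset.mem_Icc.1 hj
    calc a i
      _ < lam (2 * i) := (ha i hi).2
      _ ≤ lam (2 * j - 1) := lam_le hmono (by omega) (by omega) (by omega)
      _ < a j := (ha j hj).1
  have ha0 (j : ℕ) (hj : j ∈ Finset.Icc 1 N) : 0 ≤ a j :=
    ((lam_gap hpos hmono hj).1.trans (ha j hj).1).le
  intro i hi j hj hij
  refine hmonoa.injOn hi hj ((sq_eq_sq₀ (ha0 i hi) (ha0 j hj)).1 (Complex.ofReal_injective ?_))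
  simpa using hij

theorem exists_eval_sq_eq_zero_of_gaps (hreal : E.map (starRingEnd ℂ) = E)
    (h : GapIntegralsVanish N lam (density N lam (X * expand ℂ 2 E))) :
    ∃ a : ℕ → ℝ, (∀ j ∈ Finset.Icc 1 N, a j ∈ Ioo (lam (2 * j - 1)) (lam (2 * j))) ∧
      ∀ j ∈ Finset.Icc 1 N, E.eval ((a j : ℂ) ^ 2) = 0 := by
  have hreal' : (X * expand ℂ 2 E).map (starRingEnd ℂ) = X * expand ℂ 2 E := by
    rw [Polynomial.map_mul, map_X, map_expand, hreal]
  choose! a ha ha0 using fun j hj => exists_eval_eq_zero_of_gap hpos hmono hreal' hj (h j hj)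
  refine ⟨a, ha, fun j hj => ?_⟩
  have hne : (a j : ℂ) ≠ 0 :=
    Complex.ofReal_ne_zero.2 ((lam_gap hpos hmono hj).1.trans (ha j hj).1).ne'
  simpa [hne] using ha0 j hj

theorem eq_zero_of_gaps_of_real (hE : E.degree < N) (hreal : E.map (starRingEnd ℂ) = E)
    (h : GapIntegralsVanish N lam (density N lam (X * expand ℂ 2 E))) : E = 0 := by
  obtain ⟨a, ha, ha0⟩ := exists_eval_sq_eq_zero_of_gaps hpos hmono hreal h
  exact eq_zero_of_degree_lt_of_eval_index_eq_zero _ (injOn_sq_of_mem_gap hpos hmono ha)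
    (by simpa using hE) ha0

theorem density_map_conj (hx : x ∉ bands N lam) :
    density N lam (P.map (starRingEnd ℂ)) x = -starRingEnd ℂ (density N lam P x) := by
  have hroot := Complex.conj_eq_iff_im.2 (root_im_of_notMem_bands hpos hmono hx)
  rw [density, density, map_div₀, map_mul, Complex.conj_I, hroot, neg_mul, neg_div, neg_neg,
    ← Complex.conj_ofReal, eval_map, eval₂_at_apply, Complex.conj_ofReal]

theorem GapIntegralsVanish.map_conj (h : GapIntegralsVanish N lam (density N lam P)) :
    GapIntegralsVanish N lam (density N lam (P.map (starRingEnd ℂ))) := by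
  intro j hj
  have hlt := (lam_gap hpos hmono hj).2
  have hP := h j hj
  rw [intervalIntegral.integral_of_le hlt.le, integral_Ioc_eq_integral_Ioo] at hP ⊢
  rw [setIntegral_congr_fun measurableSet_Ioo fun x hx => density_map_conj hpos hmono
    (notMem_bands_of_mem_gap hpos hmono hj hx), integral_neg, integral_conj, hP, map_zero, neg_zero]

omit hpos hmono in
/-- The vector of gap integrals of `i P / R dη`, as a linear function of the numerator `P`. -/
noncomputable def gapIntegrals (hpos : 0 < lam 1) (hmono : StrictMonoOn lam (Icc 1 (2 * N + 1))) :
    ℂ[X] →ₗ[ℂ] (Finset.Icc 1 N → ℂ) where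
  toFun P j := ∫ x in lam (2 * j - 1)..lam (2 * j), density N lam P (x : ℂ)
  map_add' P Q := funext fun j => by
    rw [Pi.add_apply, ← intervalIntegral.integral_add (intervalIntegrable_density hpos hmono P _ _)
      (intervalIntegrable_density hpos hmono Q _ _)]
    simp only [density, eval_add, mul_add, add_div]
  map_smul' c P := funext fun j => by
    rw [Pi.smul_apply, ← intervalIntegral.integral_smul]
    simp only [density, eval_smul, smul_eq_mul, RingHom.id_apply, mul_left_comm, mul_div_assoc]

theorem gapIntegrals_eq_zero_iff :
    gapIntegrals hpos hmono P = 0 ↔ GapIntegralsVanish N lam (density N lam P) := by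
  simp [funext_iff, gapIntegrals, GapIntegralsVanish]

theorem eq_zero_of_gaps (hE : E.degree < N)
    (h : GapIntegralsVanish N lam (density N lam (X * expand ℂ 2 E))) : E = 0 := by
  have hconj := h.map_conj hpos hmono
  rw [Polynomial.map_mul, map_X, map_expand] at hconj
  rw [← gapIntegrals_eq_zero_iff hpos hmono] at h hconj
  have hmap : (E.map (starRingEnd ℂ)).map (starRingEnd ℂ) = E := by ext; simp
  have hre : E + E.map (starRingEnd ℂ) = 0 := by
    refine eq_zero_of_gaps_of_real hpos hmono ?_ ?_ ?_
    · exact (degree_add_le _ _).trans_lt (max_lt hE (degree_map_le.trans_lt hE))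
    · rw [Polynomial.map_add, hmap, add_comm]
    · rw [← gapIntegrals_eq_zero_iff hpos hmono, map_add, mul_add, map_add, h, hconj, add_zero]
  have him : Complex.I • (E - E.map (starRingEnd ℂ)) = 0 := by
    refine eq_zero_of_gaps_of_real hpos hmono ?_ ?_ ?_
    · refine (degree_smul_le _ _).trans_lt ((degree_sub_le _ _).trans_lt ?_)
      exact max_lt hE (degree_map_le.trans_lt hE)
    · rw [Polynomial.map_smul, Polynomial.map_sub, hmap, Complex.conj_I, neg_smul, ← smul_neg,
        neg_sub]
    · rw [← gapIntegrals_eq_zero_iff hpos hmono, map_smul, mul_smul_comm, map_smul, map_sub,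
        mul_sub, map_sub, h, hconj, sub_zero, smul_zero]
  have hsub := (smul_eq_zero.1 him).resolve_left Complex.I_ne_zero
  rw [← sub_eq_zero.1 hsub] at hre
  exact self_eq_neg.1 (eq_neg_of_add_eq_zero_left hre)

theorem exists_gaps_sub (P : ℂ[X]) : ∃ E : ℂ[X], E.degree < N ∧
    GapIntegralsVanish N lam (density N lam (P - X * expand ℂ 2 E)) := by
  let Φ : degreeLT ℂ N →ₗ[ℂ] (Finset.Icc 1 N → ℂ) :=
    gapIntegrals hpos hmono ∘ₗ LinearMap.mulLeft ℂ X ∘ₗ (expand ℂ 2).toLinearMap ∘ₗ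
      (degreeLT ℂ N).subtype
  have hinj : Function.Injective Φ := by
    refine (injective_iff_map_eq_zero Φ).2 fun E hE => Subtype.ext ?_
    exact eq_zero_of_gaps hpos hmono (mem_degreeLT.1 E.2)
      ((gapIntegrals_eq_zero_iff hpos hmono).1 hE)
  have hrank : Module.finrank ℂ (degreeLT ℂ N) = Module.finrank ℂ (Finset.Icc 1 N → ℂ) := by
    simp [(degreeLTEquiv ℂ N).finrank_eq]
  have : FiniteDimensional ℂ (degreeLT ℂ N) := .of_injective Φ hinj
  obtain ⟨E, hE⟩ := (LinearMap.injective_iff_surjective_of_finrank_eq_finrank hrank).1 hinj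
    (gapIntegrals hpos hmono P)
  refine ⟨E, mem_degreeLT.1 E.2, (gapIntegrals_eq_zero_iff hpos hmono).1 ?_⟩
  rw [map_sub, ← hE]
  exact sub_self _

end gaps

/-! ### Behaviour at infinity -/

section infinity

variable {N : ℕ} {lam : ℕ → ℝ} {P B : ℂ[X]} {T : ℝ[X]}

theorem tendsto_sq_mul_one_sub_prod {ι : Type*} (s : Finset ι) (a : ι → ℂ) :
    Tendsto (fun z : ℂ => z ^ 2 * (1 - ∏ j ∈ s, (1 - a j * z⁻¹ ^ 2))) (cobounded ℂ)
      (𝓝 (∑ j ∈ s, a j)) := by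
  classical
  induction s using Finset.induction_on with
  | empty => simp
  | insert i s hi ih =>
    have hprod : Tendsto (fun z : ℂ => ∏ j ∈ s, (1 - a j * z⁻¹ ^ 2)) (cobounded ℂ) (𝓝 1) := by
      simpa using tendsto_finsetProd s fun j _ =>
        ((tendsto_inv₀_cobounded (α := ℂ)).pow 2 |>.const_mul (a j)).const_sub 1
    have h := (hprod.const_mul (a i)).add ih
    rw [mul_one, ← Finset.sum_insert hi] at h
    refine h.congr' ?_
    filter_upwards [eventually_ne_cobounded (0 : ℂ)] with z hz
    have hz2 : z ^ 2 * z⁻¹ ^ 2 = 1 := by rw [← mul_pow, mul_inv_cancel₀ hz, one_pow]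
    rw [Finset.prod_insert hi]
    linear_combination (-a i * ∏ j ∈ s, (1 - a j * z⁻¹ ^ 2)) * hz2

theorem tendsto_sq_mul_one_sub_root (N : ℕ) (lam : ℕ → ℝ) :
    Tendsto (fun z => z ^ 2 * (1 - root N lam z / z ^ (2 * N + 1))) (cobounded ℂ)
      (𝓝 ((∑ j ∈ Finset.Icc 1 (2 * N + 1), (lam j : ℂ) ^ 2) / 2)) := by
  have h2 : Tendsto (fun z => 1 + root N lam z / z ^ (2 * N + 1)) (cobounded ℂ) (𝓝 2) := by
    simpa only [one_add_one_eq_two] using (tendsto_root_div N lam).const_add 1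
  refine ((tendsto_sq_mul_one_sub_prod (Finset.Icc 1 (2 * N + 1)) fun j => (lam j : ℂ) ^ 2).div h2
    two_ne_zero).congr' ?_
  filter_upwards [eventually_ne_cobounded (0 : ℂ), h2.eventually_ne two_ne_zero] with z hz hz2
  have hprod : ∏ j ∈ Finset.Icc 1 (2 * N + 1), (1 - (lam j : ℂ) ^ 2 * z⁻¹ ^ 2) =
      (root N lam z / z ^ (2 * N + 1)) ^ 2 := calc
    _ = ∏ j ∈ Finset.Icc 1 (2 * N + 1), ((z ^ 2 - (lam j : ℂ) ^ 2) / z ^ 2) :=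
      Finset.prod_congr rfl fun j _ => by field_simp
    _ = (root N lam z / z ^ (2 * N + 1)) ^ 2 := by
      rw [Finset.prod_div_distrib, Finset.prod_const, ← root_sq, div_pow, ← pow_mul, ← pow_mul,
        Nat.card_Icc, mul_comm 2, Nat.add_sub_cancel]
  rw [Pi.div_apply, hprod, div_eq_iff hz2]
  ring

theorem root_isEquivalent (N : ℕ) (lam : ℕ → ℝ) :
    root N lam ~[cobounded ℂ] (X ^ (2 * N + 1) : ℂ[X]).eval := by
  refine (isEquivalent_iff_tendsto_one ?_).2 ?_
  · filter_upwards [eventually_ne_cobounded (0 : ℂ)] with z hz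
    simpa using hz
  · exact (tendsto_root_div N lam).congr fun z => by simp

theorem tendsto_density_zero_iff :
    Tendsto (density N lam P) (cobounded ℂ) (𝓝 0) ↔ P.degree < (2 * N + 1 : ℕ) := by
  have hne : ∀ᶠ z in cobounded ℂ, root N lam z ≠ 0 := by
    filter_upwards [(tendsto_root_div N lam).eventually_ne one_ne_zero] with z hz
    exact (div_ne_zero_iff.1 hz).1
  have hlittle : Tendsto (density N lam P) (cobounded ℂ) (𝓝 0) ↔
      P.eval =o[cobounded ℂ] root N lam := by
    rw [← isLittleO_const_mul_left_iff Complex.I_ne_zero,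
      isLittleO_iff_tendsto' (hne.mono fun z hz h => absurd h hz)]
    rfl
  rw [hlittle, (root_isEquivalent N lam).isTheta.isLittleO_congr_right, ← degree_X_pow (R := ℂ)]
  refine ⟨fun h => ?_, isLittleO_cobounded_of_degree_lt⟩
  by_contra! hdeg
  refine isLittleO_irrefl ?_ ((isBigO_cobounded_of_degree_le hdeg).trans_isLittleO h)
  exact ((eventually_ne_cobounded (0 : ℂ)).mono fun z hz => by simpa using hz).frequently

theorem tendsto_residual_iff
    (hB : Tendsto (fun z => density N lam B z - Complex.I * aeval z T) (cobounded ℂ) (𝓝 0)) :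
    Tendsto (fun z => density N lam P z - Complex.I * aeval z T) (cobounded ℂ) (𝓝 0) ↔
      (P - B).degree < (2 * N + 1 : ℕ) := by
  rw [← tendsto_density_zero_iff (lam := lam)]
  constructor <;> intro h
  · have h' := h.sub hB
    rw [sub_zero] at h'
    refine h'.congr fun z => ?_
    rw [density_sub]
    ring
  · have h' := h.add hB
    rw [add_zero] at h'
    refine h'.congr fun z => ?_
    rw [density_sub]
    ring

theorem tendsto_residual_one : Tendsto (fun z => density N lam (X ^ (2 * N + 1)) z -
    Complex.I * aeval z (1 : ℝ[X])) (cobounded ℂ) (𝓝 0) := by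
  have h := (((tendsto_root_div N lam).inv₀ one_ne_zero).sub_const 1).const_mul Complex.I
  rw [inv_one, sub_self, mul_zero] at h
  refine h.congr fun z => ?_
  rw [density, inv_div, eval_pow, eval_X, map_one]
  ring

/-- The terms of `z² R(z)` that do not vanish relative to `R(z)` at infinity. -/
noncomputable def sqRootPart (N : ℕ) (lam : ℕ → ℝ) : ℂ[X] :=
  X ^ (2 * N + 1) * (X ^ 2 - C ((∑ j ∈ Finset.Icc 1 (2 * N + 1), (lam j : ℂ) ^ 2) / 2))

theorem tendsto_residual_X_sq : Tendsto (fun z => density N lam (sqRootPart N lam) z -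
    Complex.I * aeval z (X ^ 2 : ℝ[X])) (cobounded ℂ) (𝓝 0) := by
  set s := (∑ j ∈ Finset.Icc 1 (2 * N + 1), (lam j : ℂ) ^ 2) / 2 with hs
  have hroot := tendsto_root_div N lam
  have h := (((tendsto_sq_mul_one_sub_root N lam).sub_const s).div hroot one_ne_zero).const_mul
    Complex.I
  rw [← hs, sub_self, zero_div, mul_zero] at h
  refine h.congr' ?_
  filter_upwards [eventually_ne_cobounded (0 : ℂ), hroot.eventually_ne one_ne_zero] with z hz hρ
  have hne := (div_ne_zero_iff.1 hρ).1
  simp only [density, sqRootPart, ← hs, Pi.div_apply, eval_mul, eval_pow, eval_X, eval_sub, eval_C,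
    map_pow, aeval_X]
  field_simp
  ring

end infinity

/-! ### Normalized differentials -/

theorem degree_X_mul_expand_two_lt_iff {R : Type*} [CommRing R] [Nontrivial R]
    {E : R[X]} {n : ℕ} :
    (X * expand R 2 E : R[X]).degree < (2 * n + 1 : ℕ) ↔ E.degree < n := by
  rcases eq_or_ne E 0 with rfl | hE
  · simp only [map_zero, mul_zero, degree_zero, WithBot.bot_lt_natCast]
  have hE' : expand R 2 E ≠ 0 := (expand_ne_zero two_pos).2 hE
  have hXE : X * expand R 2 E ≠ 0 := monic_X.mul_right_ne_zero hE'
  rw [degree_eq_natDegree hE, degree_eq_natDegree hXE, natDegree_X_mul hE', natDegree_expand,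
    Nat.cast_lt, Nat.cast_lt]
  omega

section uniqueness

variable {N : ℕ} {lam : ℕ → ℝ} {T : ℝ[X]} {P P' B : ℂ[X]}

variable (hpos : 0 < lam 1) (hmono : StrictMonoOn lam (Icc 1 (2 * N + 1)))

include hpos hmono

theorem IsNormalized.unique (h : IsNormalized N lam T P) (h' : IsNormalized N lam T P') :
    P = P' := by
  obtain ⟨E, hE⟩ : ∃ E, P - P' = X * expand ℂ 2 E :=
    exists_eq_X_mul_expand (by rw [sub_comp, h.odd, h'.odd, neg_sub_neg, neg_sub])
  have hdeg : E.degree < N := by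
    rw [← degree_X_mul_expand_two_lt_iff, ← hE]
    exact (tendsto_residual_iff h'.tendsto).1 h.tendsto
  have hgaps : GapIntegralsVanish N lam (density N lam (P - P')) := by
    rw [← gapIntegrals_eq_zero_iff hpos hmono, map_sub,
      (gapIntegrals_eq_zero_iff hpos hmono).2 h.gaps,
      (gapIntegrals_eq_zero_iff hpos hmono).2 h'.gaps, sub_zero]
  rw [hE] at hgaps
  rw [← sub_eq_zero, hE, eq_zero_of_gaps hpos hmono hdeg hgaps, map_zero, mul_zero]

theorem exists_isNormalized (hodd : B.comp (-X) = -B)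
    (hB : Tendsto (fun z => density N lam B z - Complex.I * aeval z T) (cobounded ℂ) (𝓝 0)) :
    ∃ P, IsNormalized N lam T P := by
  obtain ⟨E, hdeg, hgaps⟩ := exists_gaps_sub hpos hmono B
  refine ⟨_, ?_, hgaps, (tendsto_residual_iff hB).2 ?_⟩
  · rw [sub_comp, hodd, odd_X_mul_expand, neg_sub_neg, neg_sub]
  · rwa [sub_sub_cancel_left, degree_neg, degree_X_mul_expand_two_lt_iff]

theorem IsNormalized.map_conj_eq (h : IsNormalized N lam T P)
    (hreal : B.map (starRingEnd ℂ) = B)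
    (hB : Tendsto (fun z => density N lam B z - Complex.I * aeval z T) (cobounded ℂ) (𝓝 0)) :
    P.map (starRingEnd ℂ) = P := by
  refine IsNormalized.unique (T := T) hpos hmono ⟨?_, h.gaps.map_conj hpos hmono, ?_⟩ h
  · simpa [Polynomial.map_comp] using congrArg (Polynomial.map (starRingEnd ℂ)) h.odd
  · rw [tendsto_residual_iff hB, ← hreal, ← Polynomial.map_sub]
    exact degree_map_le.trans_lt ((tendsto_residual_iff hB).1 h.tendsto)

end uniqueness

section numerators

variable {N : ℕ} {lam : ℕ → ℝ} {P Q B : ℂ[X]}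

theorem IsOddMonic.of_degree_sub_lt {d : ℕ} (hB : IsOddMonic d B) (hP : P.comp (-X) = -P)
    (h : (P - B).degree < (d : ℕ)) : IsOddMonic d P := by
  have hlt : (P - B).degree < B.degree := by rwa [degree_eq_natDegree hB.1.ne_zero, hB.2.1]
  rw [← add_sub_cancel B P] at hP ⊢
  exact ⟨hB.1.add_of_left hlt, (natDegree_add_eq_left_of_degree_lt hlt).trans hB.2.1, hP⟩

theorem IsOddMonic.degree_sub_lt {d : ℕ} (hP : IsOddMonic d P) (hB : IsOddMonic d B) :
    (P - B).degree < (d : ℕ) := by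
  have hdeg : P.degree = (d : ℕ) := by rw [degree_eq_natDegree hP.1.ne_zero, hP.2.1]
  refine (Polynomial.degree_sub_lt_left ?_ hP.1.ne_zero (hP.1.trans hB.1.symm)).trans_eq hdeg
  rw [hdeg, degree_eq_natDegree hB.1.ne_zero, hB.2.1]

theorem isOddMonic_X_pow (N : ℕ) : IsOddMonic (2 * N + 1) (X ^ (2 * N + 1)) :=
  ⟨monic_X_pow _, natDegree_X_pow _, by rw [X_pow_comp, Odd.neg_pow ⟨N, rfl⟩]⟩

theorem isOddMonic_sqRootPart (N : ℕ) (lam : ℕ → ℝ) :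
    IsOddMonic (2 * N + 3) (sqRootPart N lam) := by
  have hX : (X ^ (2 * N + 1) : ℂ[X]).Monic := monic_X_pow _
  refine ⟨hX.mul (monic_X_pow_sub_C _ two_ne_zero), ?_, ?_⟩
  · rw [sqRootPart, hX.natDegree_mul (monic_X_pow_sub_C _ two_ne_zero), natDegree_X_pow,
      natDegree_X_pow_sub_C]
  · rw [sqRootPart, mul_comp, sub_comp, X_pow_comp, X_pow_comp, C_comp, Odd.neg_pow ⟨N, rfl⟩,
      neg_sq, neg_mul]

theorem map_conj_sqRootPart (N : ℕ) (lam : ℕ → ℝ) :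
    (sqRootPart N lam).map (starRingEnd ℂ) = sqRootPart N lam := by
  simp [sqRootPart, Complex.conj_ofNat]

theorem gapIntegralsVanish_const_mul_iff {c : ℂ} (hc : c ≠ 0) {f : ℂ → ℂ} :
    GapIntegralsVanish N lam (fun z => c * f z) ↔ GapIntegralsVanish N lam f := by
  simp [GapIntegralsVanish, hc]

theorem dp_eq_density (N : ℕ) (lam : ℕ → ℝ) (P : ℂ[X]) :
    dp N lam P = fun z => (Real.pi⁻¹ : ℝ) * density N lam P z := by
  funext z
  rw [dp, density, Complex.ofReal_inv, ← div_div, div_right_comm, div_eq_inv_mul _ (Real.pi : ℂ)]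

theorem dq_eq_density (N : ℕ) (lam : ℕ → ℝ) (Q : ℂ[X]) :
    dq N lam Q = fun z => (12 / Real.pi : ℝ) * density N lam Q z := by
  funext z
  rw [dq, density, mul_assoc, mul_div_mul_comm, Complex.ofReal_div, Complex.ofReal_ofNat]

theorem isNumeratorP_iff : IsNumeratorP N lam P ↔ IsNormalized N lam 1 P := by
  have hpi : ((Real.pi⁻¹ : ℝ) : ℂ) ≠ 0 := Complex.ofReal_ne_zero.2 (inv_ne_zero Real.pi_ne_zero)
  rw [IsNumeratorP, dp_eq_density, gapIntegralsVanish_const_mul_iff hpi]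
  constructor
  · rintro ⟨hP, hgaps⟩
    exact ⟨hP.2.2, hgaps, (tendsto_residual_iff tendsto_residual_one).2
      (hP.degree_sub_lt (isOddMonic_X_pow N))⟩
  · intro h
    exact ⟨(isOddMonic_X_pow N).of_degree_sub_lt h.odd
      ((tendsto_residual_iff tendsto_residual_one).1 h.tendsto), h.gaps⟩

theorem isNumeratorQ_iff : IsNumeratorQ N lam Q ↔ IsNormalized N lam (X ^ 2) Q := by
  have hc : ((12 / Real.pi : ℝ) : ℂ) ≠ 0 :=
    Complex.ofReal_ne_zero.2 (div_ne_zero (by norm_num) Real.pi_ne_zero)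
  have htendsto : Tendsto (fun z => dq N lam Q z - 12 * Complex.I / Real.pi * z ^ 2)
      (cobounded ℂ) (𝓝 0) ↔ Tendsto (fun z => density N lam Q z -
      Complex.I * aeval z (X ^ 2 : ℝ[X])) (cobounded ℂ) (𝓝 0) := by
    rw [iff_comm, ← tendsto_const_smul_iff₀ hc, smul_zero]
    refine tendsto_congr fun z => ?_
    rw [dq_eq_density, map_pow, aeval_X, smul_eq_mul, Complex.ofReal_div, Complex.ofReal_ofNat]
    ring
  rw [IsNumeratorQ, htendsto, dq_eq_density, gapIntegralsVanish_const_mul_iff hc]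
  refine ⟨fun h => ⟨h.1.2.2, h.2.1, h.2.2⟩, fun h => ⟨?_, h.gaps, h.tendsto⟩⟩
  refine (isOddMonic_sqRootPart N lam).of_degree_sub_lt h.odd ?_
  refine ((tendsto_residual_iff tendsto_residual_X_sq).1 h.tendsto).trans ?_
  exact_mod_cast (by omega : 2 * N + 1 < 2 * N + 3)

end numerators

theorem HasHilbertTransform.const_mul {G : Set ℝ} {f : ℝ → ℂ} {x : ℝ} {a : ℂ}
    (h : HasHilbertTransform G f x a) (c : ℂ) :
    HasHilbertTransform G (fun y => c * f y) x (c * a) := by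
  refine (Tendsto.const_mul c h).congr fun ε => ?_
  simp only [mul_div_assoc, integral_const_mul, mul_left_comm]

/-! ### Sign of the density -/

section sign

open scoped ComplexOrder

variable {a b c x : ℝ}

theorem div_bandRoot_nonneg (hb : 0 < b) (hx : b ≤ x) : 0 ≤ (x : ℂ) / bandRoot (-b) b x := by
  rw [bandRoot_of_ge (by linarith) hx]
  exact_mod_cast div_nonneg (hb.le.trans hx) (Real.sqrt_nonneg _)

theorem I_mul_div_bandRoot_nonneg (h0 : 0 ≤ x) (hx : x ≤ b) :
    0 ≤ Complex.I * (x / bandRoot (-b) b x) := by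
  rw [bandRoot_of_mem (by linarith) hx, ← mul_div_assoc, mul_div_mul_left _ _ Complex.I_ne_zero]
  exact_mod_cast div_nonneg h0 (Real.sqrt_nonneg _)

theorem pairFactor_nonneg (hb : a < b) (hc : 0 ≤ c) (hca : c < a) (h0 : 0 ≤ x)
    (hx : x ≤ c ∨ b ≤ x) : 0 ≤ ((x : ℂ) ^ 2 - c ^ 2) / pairRoot a b x := by
  have ha : 0 < a := hc.trans_lt hca
  rcases hx with hx | hx
  · rw [pairRoot_of_le ha hb h0 (hx.trans hca.le), div_neg, ← neg_div, neg_sub]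
    exact_mod_cast div_nonneg (sub_nonneg.2 (pow_le_pow_left₀ h0 hx 2)) (Real.sqrt_nonneg _)
  · rw [pairRoot_of_ge ha hb hx]
    have hcx : c ≤ x := (hca.trans hb).le.trans hx
    exact_mod_cast div_nonneg (sub_nonneg.2 (pow_le_pow_left₀ hc hcx 2)) (Real.sqrt_nonneg _)

theorem I_mul_pairFactor_nonneg (hb : a < b) (hc : 0 ≤ c) (hca : c < a) (hx : a ≤ x)
    (hx' : x ≤ b) : 0 ≤ Complex.I * ((x : ℂ) ^ 2 - c ^ 2) / pairRoot a b x := by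
  rw [pairRoot_of_mem (hc.trans_lt hca) hb hx hx', mul_div_mul_left _ _ Complex.I_ne_zero]
  exact_mod_cast div_nonneg (sub_nonneg.2 (pow_le_pow_left₀ hc (hca.le.trans hx) 2))
    (Real.sqrt_nonneg _)

variable {N : ℕ} {lam : ℕ → ℝ} {P : ℂ[X]}

variable (hpos : 0 < lam 1) (hmono : StrictMonoOn lam (Icc 1 (2 * N + 1)))

include hpos hmono

theorem IsOddMonic.exists_eval_eq_prod (hP : IsOddMonic (2 * N + 1) P)
    (hreal : P.map (starRingEnd ℂ) = P) (hgaps : GapIntegralsVanish N lam (density N lam P)) :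
    ∃ a : ℕ → ℝ, (∀ j ∈ Finset.Icc 1 N, a j ∈ Ioo (lam (2 * j - 1)) (lam (2 * j))) ∧
      ∀ z, P.eval z = z * ∏ j ∈ Finset.Icc 1 N, (z ^ 2 - (a j : ℂ) ^ 2) := by
  obtain ⟨E, rfl⟩ := exists_eq_X_mul_expand hP.2.2
  have hE : E.map (starRingEnd ℂ) = E := by
    rw [Polynomial.map_mul, map_X, map_expand] at hreal
    exact expand_injective two_pos (mul_left_cancel₀ X_ne_zero hreal)
  obtain ⟨a, ha, ha0⟩ := exists_eval_sq_eq_zero_of_gaps hpos hmono hE hgaps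
  have hmonic : E.Monic := (monic_expand_iff two_pos).1 (monic_X.of_mul_monic_left hP.1)
  have hnat : E.natDegree = N := by
    have := hP.2.1
    rw [natDegree_X_mul (hmonic.expand two_pos).ne_zero, natDegree_expand] at this
    omega
  have hdeg : E.degree = (Finset.Icc 1 N).card := by
    rw [degree_eq_natDegree hmonic.ne_zero, hnat, Nat.card_Icc, Nat.add_sub_cancel]
  have hnodal : E = Lagrange.nodal (Finset.Icc 1 N) fun j => (a j : ℂ) ^ 2 := by
    refine eq_of_degree_le_of_eval_index_eq _ (injOn_sq_of_mem_gap hpos hmono ha) hdeg.le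
      (hdeg.trans Lagrange.degree_nodal.symm) ?_ fun j hj => ?_
    · rw [hmonic.leadingCoeff, Lagrange.nodal_monic.leadingCoeff]
    · exact (ha0 j hj).trans
        (Lagrange.eval_nodal_at_node (v := fun j => (a j : ℂ) ^ 2) hj).symm
  refine ⟨a, ha, fun z => ?_⟩
  rw [eval_mul, eval_X, expand_eval, hnodal, Lagrange.eval_nodal]

theorem density_nonneg (hP : IsOddMonic (2 * N + 1) P) (hreal : P.map (starRingEnd ℂ) = P)
    (hgaps : GapIntegralsVanish N lam (density N lam P)) (hx : x ∈ bandsPos N lam) :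
    0 ≤ density N lam P x := by
  obtain ⟨a, ha, hP⟩ := hP.exists_eval_eq_prod hpos hmono hreal hgaps
  have hx0 := (bandsPos_subset_Icc hpos hmono hx).1
  have ha0 (j : ℕ) (hj : j ∈ Finset.Icc 1 N) : 0 ≤ a j :=
    ((lam_gap hpos hmono hj).1.trans (ha j hj).1).le
  have hfactor (j : ℕ) (hj : j ∈ Finset.Icc 1 N) (h : x ≤ lam (2 * j - 1) ∨ lam (2 * j + 1) ≤ x) :
      0 ≤ ((x : ℂ) ^ 2 - (a j : ℂ) ^ 2) / pairRoot (lam (2 * j)) (lam (2 * j + 1)) x :=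
    pairFactor_nonneg (lam_band hpos hmono hj).2 (ha0 j hj) (ha j hj).2 hx0
      (h.imp_left fun h => h.trans (ha j hj).1.le)
  have hdensity : density N lam P x = Complex.I * (x / bandRoot (-lam 1) (lam 1) x) *
      ∏ j ∈ Finset.Icc 1 N,
        ((x : ℂ) ^ 2 - (a j : ℂ) ^ 2) / pairRoot (lam (2 * j)) (lam (2 * j + 1)) x := by
    rw [density, hP, root_eq, Finset.prod_div_distrib, mul_div_assoc, mul_div_mul_comm, mul_assoc]
  rw [hdensity]
  rcases mem_bandsPos.1 hx with h | ⟨k, hk, h⟩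
  · refine mul_nonneg (I_mul_div_bandRoot_nonneg hx0 h.2)
      (Finset.prod_nonneg fun j hj => hfactor j hj (.inl (h.2.trans ?_)))
    rw [Finset.mem_Icc] at hj
    exact lam_le hmono le_rfl (by omega) (by omega)
  · rw [mul_comm Complex.I, ← Finset.mul_prod_erase _ _ hk, mul_assoc, ← mul_assoc Complex.I,
      ← mul_div_assoc Complex.I]
    have hx1 : lam 1 ≤ x := by
      have := Finset.mem_Icc.1 hk
      exact (lam_le hmono le_rfl (by omega) (by omega)).trans h.1
    refine mul_nonneg (div_bandRoot_nonneg hpos hx1) (mul_nonneg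
      (I_mul_pairFactor_nonneg (lam_band hpos hmono hk).2 (ha0 k hk) (ha k hk).2 h.1 h.2)
      (Finset.prod_nonneg fun j hj => ?_))
    rw [Finset.mem_erase] at hj
    exact hfactor j hj.2 (le_or_ge_of_mem_band hmono hk hj.2 hj.1 h)

end sign

section solution

variable {N : ℕ} {lam : ℕ → ℝ} {P Q : ℂ[X]} {x : ℝ}

variable (hpos : 0 < lam 1) (hmono : StrictMonoOn lam (Icc 1 (2 * N + 1)))

include hpos hmono

theorem existsUnique_isNumeratorP : ∃! P, IsNumeratorP N lam P := by
  obtain ⟨P, hP⟩ := exists_isNormalized hpos hmono (isOddMonic_X_pow N).2.2 tendsto_residual_one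
  exact ⟨P, isNumeratorP_iff.2 hP, fun _ h => (isNumeratorP_iff.1 h).unique hpos hmono hP⟩

theorem existsUnique_isNumeratorQ : ∃! Q, IsNumeratorQ N lam Q := by
  obtain ⟨Q, hQ⟩ :=
    exists_isNormalized hpos hmono (isOddMonic_sqRootPart N lam).2.2 tendsto_residual_X_sq
  exact ⟨Q, isNumeratorQ_iff.2 hQ, fun _ h => (isNumeratorQ_iff.1 h).unique hpos hmono hQ⟩

theorem integrableOn_dp (P : ℂ[X]) :
    IntegrableOn (fun x : ℝ => dp N lam P x) (bands N lam) := by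
  rw [dp_eq_density]
  exact (integrableOn_density hpos hmono P).const_mul _

theorem integrableOn_dq (Q : ℂ[X]) :
    IntegrableOn (fun x : ℝ => dq N lam Q x) (bands N lam) := by
  rw [dq_eq_density]
  exact (integrableOn_density hpos hmono Q).const_mul _

namespace IsNumeratorP

variable (hP : IsNumeratorP N lam P)

include hP

theorem map_conj_eq : P.map (starRingEnd ℂ) = P :=
  (isNumeratorP_iff.1 hP).map_conj_eq hpos hmono (by simp) tendsto_residual_one

theorem dp_neg (hx : x ∈ bands N lam) : dp N lam P (-x : ℝ) = -dp N lam P x := by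
  have hreal := hP.map_conj_eq hpos hmono
  simp only [dp_eq_density, density_neg_of_mem_bands hpos hmono hP.1.2.2 hreal hx, mul_neg]

theorem dp_im (hx : x ∈ bands N lam) : (dp N lam P x).im = 0 := by
  have hreal := hP.map_conj_eq hpos hmono
  rw [dp_eq_density, Complex.im_ofReal_mul, density_im_of_mem_bands hpos hmono hreal hx, mul_zero]

theorem hasHilbertTransform (hx : x ∈ bands N lam \ branchPoints N lam) :
    HasHilbertTransform (bands N lam) (fun y => dp N lam P y) x (1 / Real.pi) := by
  have hreal := hP.map_conj_eq hpos hmono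
  rw [dp_eq_density]
  simpa using ((isNumeratorP_iff.1 hP).hasHilbertTransform hpos hmono hreal hx).const_mul
    (Real.pi⁻¹ : ℝ)

theorem solvesNDR : SolvesNDR (bandsPos N lam) (fun _ => 0) (fun η => η)
    fun x => dp N lam P x := by
  have hreal := hP.map_conj_eq hpos hmono
  rw [dp_eq_density]
  refine (isNumeratorP_iff.1 hP).solvesNDR_const_mul hpos hmono hreal fun η => ?_
  simp only [eval_one, intervalIntegral.integral_const, smul_eq_mul]
  field_simp
  ring

theorem dp_re_nonneg (hx : x ∈ bandsPos N lam) : 0 ≤ (dp N lam P x).re := by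
  have hnormalized := isNumeratorP_iff.1 hP
  have hnonneg := density_nonneg hpos hmono hP.1 (hP.map_conj_eq hpos hmono) hnormalized.gaps hx
  rw [dp_eq_density, Complex.re_ofReal_mul]
  exact mul_nonneg (by positivity) (Complex.le_def.1 hnonneg).1

end IsNumeratorP

namespace IsNumeratorQ

variable (hQ : IsNumeratorQ N lam Q)

include hQ

theorem map_conj_eq : Q.map (starRingEnd ℂ) = Q :=
  (isNumeratorQ_iff.1 hQ).map_conj_eq hpos hmono (map_conj_sqRootPart N lam) tendsto_residual_X_sq

theorem dq_neg (hx : x ∈ bands N lam) : dq N lam Q (-x : ℝ) = -dq N lam Q x := by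
  have hreal := hQ.map_conj_eq hpos hmono
  simp only [dq_eq_density, density_neg_of_mem_bands hpos hmono hQ.1.2.2 hreal hx, mul_neg]

theorem dq_im (hx : x ∈ bands N lam) : (dq N lam Q x).im = 0 := by
  have hreal := hQ.map_conj_eq hpos hmono
  rw [dq_eq_density, Complex.im_ofReal_mul, density_im_of_mem_bands hpos hmono hreal hx, mul_zero]

theorem hasHilbertTransform (hx : x ∈ bands N lam \ branchPoints N lam) :
    HasHilbertTransform (bands N lam) (fun y => dq N lam Q y) x
      (12 * (x : ℂ) ^ 2 / Real.pi) := by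
  have hreal := hQ.map_conj_eq hpos hmono
  rw [dq_eq_density]
  simpa [div_mul_eq_mul_div] using
    ((isNumeratorQ_iff.1 hQ).hasHilbertTransform hpos hmono hreal hx).const_mul
      (12 / Real.pi : ℝ)

theorem solvesNDR : SolvesNDR (bandsPos N lam) (fun _ => 0) (fun η => 4 * η ^ 3)
    fun x => dq N lam Q x := by
  have hreal := hQ.map_conj_eq hpos hmono
  rw [dq_eq_density]
  refine (isNumeratorQ_iff.1 hQ).solvesNDR_const_mul hpos hmono hreal fun η => ?_
  simp only [eval_pow, eval_X, integral_pow]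
  field_simp
  ring

end IsNumeratorQ

end solution

end SolitonCondensate

open SolitonCondensate

theorem theorem3p1 (N : ℕ) (lam : ℕ → ℝ) (hpos : 0 < lam 1)
    (hmono : StrictMonoOn lam (Set.Icc 1 (2 * N + 1))) :
    (∃! P : Polynomial ℂ, SolitonCondensate.IsNumeratorP N lam P) ∧
    (∃! Q : Polynomial ℂ, SolitonCondensate.IsNumeratorQ N lam Q) ∧
    ∀ P Q : Polynomial ℂ,
      SolitonCondensate.IsNumeratorP N lam P → SolitonCondensate.IsNumeratorQ N lam Q →
      ∀ u v : ℝ → ℂ,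
        (∀ η : ℝ, u η = SolitonCondensate.dp N lam P (η : ℂ)) →
        (∀ η : ℝ, v η = SolitonCondensate.dq N lam Q (η : ℂ)) →
        -- `u` and `v` are odd and real valued
        (∀ η ∈ SolitonCondensate.bands N lam \ SolitonCondensate.branchPoints N lam,
          u (-η) = -u η ∧ v (-η) = -v η ∧ (u η).im = 0 ∧ (v η).im = 0) ∧
        -- they solve the Hilbert transform equations
        MeasureTheory.IntegrableOn u (SolitonCondensate.bands N lam) ∧
        MeasureTheory.IntegrableOn v (SolitonCondensate.bands N lam) ∧
        (∀ η ∈ SolitonCondensate.bands N lam \ SolitonCondensate.branchPoints N lam,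
          SolitonCondensate.HasHilbertTransform (SolitonCondensate.bands N lam) u η
            (1 / Real.pi) ∧
          SolitonCondensate.HasHilbertTransform (SolitonCondensate.bands N lam) v η
            (12 * (η : ℂ) ^ 2 / Real.pi)) ∧
        -- they solve the dispersion relations with `σ = 0`
        SolitonCondensate.SolvesNDR (SolitonCondensate.bandsPos N lam) (fun _ => 0)
          (fun η => η) u ∧
        SolitonCondensate.SolvesNDR (SolitonCondensate.bandsPos N lam) (fun _ => 0)
          (fun η => 4 * η ^ 3) v ∧
        -- `u` is nonnegative on the positive bands
        (∀ η ∈ SolitonCondensate.bandsPos N lam \ SolitonCondensate.branchPoints N lam,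
          0 ≤ (u η).re) := by
  refine ⟨existsUnique_isNumeratorP hpos hmono, existsUnique_isNumeratorQ hpos hmono,
    fun P Q hP hQ u v hu hv => ?_⟩
  obtain rfl : u = fun η : ℝ => dp N lam P η := funext hu
  obtain rfl : v = fun η : ℝ => dq N lam Q η := funext hv
  exact ⟨fun η hη => ⟨hP.dp_neg hpos hmono hη.1, hQ.dq_neg hpos hmono hη.1,
      hP.dp_im hpos hmono hη.1, hQ.dq_im hpos hmono hη.1⟩,
    integrableOn_dp hpos hmono P, integrableOn_dq hpos hmono Q,
    fun η hη => ⟨hP.hasHilbertTransform hpos hmono hη, hQ.hasHilbertTransform hpos hmono hη⟩,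
    hP.solvesNDR hpos hmono, hQ.solvesNDR hpos hmono,
    fun η hη => hP.dp_re_nonneg hpos hmono hη.1⟩
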